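/- Let $Q(x)=\prod_{j\ge1}(1-x^j)^{-j}$ for $|x|<1$, and let $q(n)=[x^n]Q(x)$ be its Taylor coefficients. Put $a(r)=rQ'(r)/Q(r)$ and $b(r)=rQ'(r)/Q(r)+r^2Q''(r)/Q(r)-r^2\bigl(Q'(r)/Q(r)\bigr)^2$ for $0<r<1$; for $n\ge1$ let $r_n\in(0,1)$ be the unique solution of $a(r_n)=n$. Put $\delta(r)=(\log\frac1r)^{5/3}/\log a(r)$, so that $\delta(r_n)=(\log\frac1{r_n})^{5/3}/\log n$. (i) $Q$ is Hayman-admissible with locality function $\delta$: $Q$ is analytic in $|x|<1$; for all $r<1$ close enough to $1$, $Q(r)>0$ and $0<\delta(r)<\pi$; and, as $r\to1^-$, $a(r)\to\infty$ and $b(r)\to\infty$; $Q(re^{i\theta})\sim Q(r)e^{i\theta a(r)-\theta^2b(r)/2}$ uniformly for $|\theta|\le\delta(r)$; $Q(re^{i\theta})=o\bigl(Q(r)/\sqrt{b(r)}\bigr)$ uniformly for $\delta(r)<|\theta|\le\pi$. (ii) Let $\beta>0$ and let $(d_n)$ be a real sequence with $$d_n=\Bigl(\frac{2\zeta(3)}{n}\Bigr)^{1/3}-\frac1{36n}+O(n^{-1-\beta}),\qquad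 n\to\infty.$$ Let $F$ be analytic in $|x|<1$ and suppose that (A) $F(r_ne^{i\theta})/F(r_n)\to1$ as $n\to\infty$, uniformly for $|\theta|\le\delta(r_n)$; (B) there are constants $C>0$ and $\eta\in(0,2/3)$ with $F(x)=O\bigl(e^{C/(1-|x|)^\eta}\bigr)$ as $|x|\to1^-$. Then there is a constant $c>0$ such that, as $n\to\infty$, $$\frac{1}{q(n)}[x^n]\,Q(x)F(x)=F(e^{-d_n})\,(1+o(1))+O\bigl(e^{-cn^{2/9}/\log^2 n}\bigr).$$ -/

import Mathlib

open Filter Topology Asymptotics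

namespace PlanePartition

/-- The `n`-th Taylor coefficient `[x^n] G(x)` at the origin. -/
noncomputable def taylorCoeff (G : ℂ → ℂ) (n : ℕ) : ℂ :=
  iteratedDeriv n G 0 / (n.factorial : ℂ)

/-- MacMahon's function `Q(x) = ∏_{j ≥ 1} (1 - x^j)^{-j}` (used for `|x| < 1`). -/
noncomputable def Q (x : ℂ) : ℂ :=
  ∏' j : ℕ, ((1 - x ^ (j + 1)) ^ (j + 1))⁻¹

/-- `q(n)`, the `n`-th Taylor coefficient of `Q`. -/
noncomputable def q (n : ℕ) : ℂ := taylorCoeff Q n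

/-- `a(r) = r G'(r) / G(r)`. The functions `G` in question are real on the real axis, so that the
real part only serves to make `a(r)` a real number; likewise for `b(r)` below. -/
noncomputable def haymanA (G : ℂ → ℂ) (r : ℝ) : ℝ :=
  ((r : ℂ) * deriv G r / G r).re

/-- `b(r) = r G'(r)/G(r) + r² G''(r)/G(r) - r² (G'(r)/G(r))²`. -/
noncomputable def haymanB (G : ℂ → ℂ) (r : ℝ) : ℝ :=
  ((r : ℂ) * deriv G r / G r + (r : ℂ) ^ 2 * deriv (deriv G) r / G r
    - (r : ℂ) ^ 2 * (deriv G r / G r) ^ 2).re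

/-- The point `r e^{iθ}`. -/
noncomputable def polar (r θ : ℝ) : ℂ := (r : ℂ) * Complex.exp (Complex.I * (θ : ℂ))

/-- Hayman admissibility in the unit disc, with locality function `δ`. -/
structure HaymanAdmissible (G : ℂ → ℂ) (δ : ℝ → ℝ) : Prop where
  analytic : DifferentiableOn ℂ G (Metric.ball 0 1)
  /-- near `1`, `G` is real and positive and `0 < δ < π` -/
  positive : ∃ R₀ : ℝ, 0 < R₀ ∧ R₀ < 1 ∧ ∀ r : ℝ, R₀ < r → r < 1 →
    (G r).im = 0 ∧ 0 < (G r).re ∧ 0 < δ r ∧ δ r < Real.pi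
  capture_a : Tendsto (haymanA G) (𝓝[<] 1) atTop
  capture_b : Tendsto (haymanB G) (𝓝[<] 1) atTop
  /-- `G(r e^{iθ}) ~ G(r) e^{iθ a(r) - θ² b(r) / 2}` uniformly for `|θ| ≤ δ(r)` -/
  locality : ∀ ε : ℝ, 0 < ε → ∀ᶠ r : ℝ in 𝓝[<] 1, ∀ θ : ℝ, |θ| ≤ δ r →
    ‖G (polar r θ) / (G r * Complex.exp
        (Complex.I * (θ : ℂ) * (haymanA G r : ℂ) - (θ : ℂ) ^ 2 * (haymanB G r : ℂ) / 2)) - 1‖ ≤ ε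
  /-- `G(r e^{iθ}) = o(G(r) / √b(r))` uniformly for `δ(r) < |θ| ≤ π` -/
  decay : ∀ ε : ℝ, 0 < ε → ∀ᶠ r : ℝ in 𝓝[<] 1, ∀ θ : ℝ, δ r < |θ| → |θ| ≤ Real.pi →
    ‖G (polar r θ)‖ ≤ ε * (‖G r‖ / Real.sqrt (haymanB G r))

/-- The locality function of `Q`: `δ(r) = (log (1/r))^{5/3} / log a(r)`. At the point
`r = e^{-d}` with `a(r) = n` it equals `d^{5/3} / log n`. -/
noncomputable def locδ (r : ℝ) : ℝ :=
  (-Real.log r) ^ (5 / 3 : ℝ) / Real.log (haymanA Q r)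

/-- Condition (A), relative to a locality function `δ`: if `r = r_n` is the solution in `(0,1)` of
`a(r) = n`, where `a` is formed from `Q`, then `F(r_n e^{iθ}) / F(r_n) → 1` as `n → ∞`, uniformly
for `|θ| ≤ δ(r_n)`. -/
def ConditionA (F : ℂ → ℂ) (δ : ℝ → ℝ) : Prop :=
  ∀ ε : ℝ, 0 < ε → ∀ᶠ n : ℕ in atTop, ∀ r : ℝ, 0 < r → r < 1 → haymanA Q r = (n : ℝ) →
    ∀ θ : ℝ, |θ| ≤ δ r → ‖F (polar r θ) / F r - 1‖ ≤ ε

/-- Condition (B): `F(x) = O(e^{C / (1 - |x|)^η})` as `|x| → 1`, `|x| < 1`, for some `C > 0` and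
`0 < η < 2/3`. -/
def ConditionB (F : ℂ → ℂ) : Prop :=
  ∃ C η : ℝ, 0 < C ∧ 0 < η ∧ η < 2 / 3 ∧
    F =O[comap (fun x : ℂ => ‖x‖) (𝓝[<] (1 : ℝ))]
      fun x : ℂ => Real.exp (C / (1 - ‖x‖) ^ η)

end PlanePartition

/-!
Write `r = e^(-d)`. The logarithm of `Q` is the double series `∑ (j / k) x^(j k)` over `j, k ≥ 1`,
whose coefficients are positive, and `a` and `b` are its first two images under `r d/dr`
(`Q_eq_exp`, `haymanA_Q`, `haymanB_Q`).

Positivity gives everything needed for admissibility. The series is at most `2 / d²`, hence its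
`s`-th image under `r d/dr` is `O(d^(-s-2))` (`logSeriesReal_le`), and the terms with `k = 1` show
that this is the right order (`le_logSeriesReal`). On the major arc the Taylor remainder of
`log Q` is `O(δ³ d^(-5)) = O(1 / log³ a)` (`norm_Q_polar_div_sub_one_le`). On the minor arcs, comparing
only the terms with `k = 1`, which sum to `x / (1 - x)²`, saves a factor `exp (-δ² / (20 d⁴))`,
and `δ² / d⁴` is of order `a^(2/9) / log² a` (`norm_Q_polar_le`, `locδ_bounds`).

For the coefficients, Cauchy's formula on `|x| = r_n` makes the ratio `[x^n] Q F / q(n)` a mean of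
`F` against a complex weight which is nearly Gaussian on the arc where `F ≈ F(r_n)`; since
`η / 3 < 2 / 9`, condition (B) is harmless on the minor arcs (`norm_coeff_ratio_sub_le`).

It remains to replace `F(r_n)` by `F(e^(-d_n))`. Summing the series over `j` first gives
`a = 2 ζ(3) / d³ + O(d^(-3/2))`, so that `r_n = e^(-d)` with `d = (2 ζ(3) / n)^(1/3) + O(n^(-5/6))`
(`exists_saddle_bounds`); in particular the term `1 / (36 n)` is below the precision required here.
Condition (A) speaks about an arc of the circle `|x| = r_n` only, but that arc has length about
`n^(-5/9) / log n`, much more than the distance `O(n^(-5/6))` from `r_n` to `e^(-d_n)`. A three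
lines argument in the coordinate `r exp (± δ sinh u)` carries the estimate over, at the cost of a
power `u = O(n^(-5/18) log n)` of the bound `exp (O(n^(η/3)))` for `F` (`norm_le_of_arc`,
`norm_sub_le_of_arc`). When `F(r_n)` is smaller than the admitted error this is applied to `F`
itself, and otherwise to `F / F(r_n) - 1`.
-/

namespace PlanePartition

/-! ### The logarithm of MacMahon's function as a double series -/

/-- The exponent `j k` of the pair `(j, k)`, both shifted to start from `1`. -/
def expo (p : ℕ × ℕ) : ℕ := (p.1 + 1) * (p.2 + 1)

/-- The coefficient `(j / k) (j k) ^ s` of the pair `(j, k)`, both shifted to start from `1`. -/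
noncomputable def coef (s : ℕ) (p : ℕ × ℕ) : ℝ :=
  ((p.1 : ℝ) + 1) / ((p.2 : ℝ) + 1) * (expo p : ℝ) ^ s

/-- The function `∑_{j, k ≥ 1} (j / k) (j k) ^ s x ^ (j k)`, which is `(x d/dx) ^ s log Q(x)`. The
double sum is kept over pairs rather than collected into a power series. -/
noncomputable def logSeries (s : ℕ) (x : ℂ) : ℂ := ∑' p, (coef s p : ℂ) * x ^ expo p

/-- The restriction of `logSeries s` to the real axis. -/
noncomputable def logSeriesReal (s : ℕ) (r : ℝ) : ℝ := ∑' p, coef s p * r ^ expo p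

lemma expo_pos (p : ℕ × ℕ) : 0 < expo p := by unfold expo; positivity

lemma coef_pos (s : ℕ) (p : ℕ × ℕ) : 0 < coef s p := by
  have := expo_pos p
  unfold coef; positivity

lemma coef_succ (s : ℕ) (p : ℕ × ℕ) : coef (s + 1) p = coef s p * expo p := by
  unfold coef; ring

lemma coef_le (s : ℕ) (p : ℕ × ℕ) : coef s p ≤ (expo p : ℝ) ^ (s + 1) := by
  have h : ((p.1 : ℝ) + 1) / ((p.2 : ℝ) + 1) ≤ expo p := by
    unfold expo
    push_cast
    rw [div_le_iff₀ (by positivity), mul_assoc]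
    have : (0:ℝ) ≤ p.2 := by positivity
    exact le_mul_of_one_le_right (by positivity) (by nlinarith)
  unfold coef
  rw [pow_succ']
  gcongr

lemma summable_coef_mul_pow (s : ℕ) {r : ℝ} (h0 : 0 ≤ r) (h1 : r < 1) :
    Summable fun p => coef s p * r ^ expo p := by
  obtain ⟨B, hB⟩ := (tendsto_pow_const_mul_const_pow_of_abs_lt_one (s + 3)
    (by rwa [abs_of_nonneg h0] : |r| < 1)).bddAbove_range
  have hs : Summable fun n : ℕ => 1 / ((n : ℝ) + 1) ^ 2 := by
    have := (summable_nat_add_iff 1).2 (Real.summable_one_div_nat_pow.2 one_lt_two)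
    simpa using this
  have hp := (hs.mul_of_nonneg hs (fun n => by positivity) (fun n => by positivity)).mul_left B
  refine hp.of_nonneg_of_le (fun p => mul_nonneg (coef_pos s p).le (by positivity)) fun p => ?_
  have hm : (0 : ℝ) < expo p := by exact_mod_cast expo_pos p
  have h2 : (expo p : ℝ) ^ (s + 3) * r ^ expo p ≤ B := hB ⟨expo p, rfl⟩
  have h3 : 1 / ((p.1 : ℝ) + 1) ^ 2 * (1 / ((p.2 : ℝ) + 1) ^ 2) = 1 / (expo p : ℝ) ^ 2 := by
    unfold expo; push_cast; field_simp
  rw [h3, mul_one_div, le_div_iff₀ (by positivity)]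
  calc coef s p * r ^ expo p * (expo p : ℝ) ^ 2
      ≤ (expo p : ℝ) ^ (s + 1) * r ^ expo p * (expo p : ℝ) ^ 2 := by gcongr; exact coef_le s p
    _ = (expo p : ℝ) ^ (s + 3) * r ^ expo p := by ring
    _ ≤ B := h2

lemma norm_coef_mul_pow (s : ℕ) (p : ℕ × ℕ) (x : ℂ) :
    ‖(coef s p : ℂ) * x ^ expo p‖ = coef s p * ‖x‖ ^ expo p := by
  rw [norm_mul, norm_pow, Complex.norm_real, Real.norm_of_nonneg (coef_pos s p).le]

lemma summable_logSeries (s : ℕ) {x : ℂ} (hx : ‖x‖ < 1) :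
    Summable fun p => (coef s p : ℂ) * x ^ expo p := by
  refine Summable.of_norm ?_
  simp_rw [norm_coef_mul_pow]
  exact summable_coef_mul_pow s (norm_nonneg x) hx

lemma logSeries_ofReal (s : ℕ) (r : ℝ) : logSeries s r = (logSeriesReal s r : ℂ) := by
  simp [logSeries, logSeriesReal, Complex.ofReal_tsum]

/-- Termwise differentiation. -/
lemma logSeries_differentiableAt_and_mul_deriv (s : ℕ) {x : ℂ} (hx : ‖x‖ < 1) :
    DifferentiableAt ℂ (logSeries s) x ∧ x * deriv (logSeries s) x = logSeries (s + 1) x := by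
  obtain ⟨R, hxR, hR⟩ := exists_between hx
  have hR0 : 0 ≤ R := (norm_nonneg x).trans hxR.le
  have hu := summable_coef_mul_pow s hR0 hR
  have hd : ∀ p, DifferentiableOn ℂ (fun x : ℂ => (coef s p : ℂ) * x ^ expo p)
      (Metric.ball 0 R) := fun p => by fun_prop
  have hle : ∀ p, ∀ w ∈ Metric.ball (0 : ℂ) R,
      ‖(coef s p : ℂ) * w ^ expo p‖ ≤ coef s p * R ^ expo p := fun p w hw => by
    rw [norm_coef_mul_pow]
    have := (coef_pos s p).le
    rw [mem_ball_zero_iff] at hw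
    gcongr
  have hxm : x ∈ Metric.ball (0 : ℂ) R := by simpa using hxR
  refine ⟨(Complex.differentiableOn_tsum_of_summable_norm hu hd Metric.isOpen_ball
    hle).differentiableAt (Metric.isOpen_ball.mem_nhds hxm), ?_⟩
  have h := (Complex.hasSum_deriv_of_summable_norm hu hd Metric.isOpen_ball hle hxm).mul_left x
  change HasSum _ (x * deriv (logSeries s) x) at h
  rw [← h.tsum_eq, logSeries]
  refine tsum_congr fun p => ?_
  obtain ⟨m, hm⟩ : ∃ m, expo p = m + 1 := ⟨expo p - 1, by have := expo_pos p; omega⟩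
  rw [coef_succ, hm]
  simp
  ring

/-- The double series `∑ j x ^ (j k) / k` exponentiates to MacMahon's product. -/
lemma Q_eq_exp {x : ℂ} (hx : ‖x‖ < 1) : Q x = Complex.exp (logSeries 0 x) := by
  have h := (summable_logSeries 0 hx).hasSum
  have h2 : ∀ j : ℕ, HasSum (fun k : ℕ => (coef 0 (j, k) : ℂ) * x ^ expo (j, k))
      (((j : ℂ) + 1) * -Complex.log (1 - x ^ (j + 1))) := fun j => by
    have hj : ‖x ^ (j + 1)‖ < 1 := by
      rw [norm_pow]; exact pow_lt_one₀ (norm_nonneg x) hx (by omega)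
    refine ((Complex.hasSum_taylorSeries_neg_log' hj).mul_left ((j : ℂ) + 1)).congr_fun ?_
    intro k
    simp only [coef, expo]
    push_cast
    rw [pow_mul]
    ring
  have h3 := (h.prod_fiberwise h2).cexp
  rw [Q, ← logSeries] at *
  rw [← h3.tprod_eq]
  refine tprod_congr fun j => ?_
  have hj : 1 - x ^ (j + 1) ≠ 0 := by
    intro h0
    have : ‖x ^ (j + 1)‖ < 1 := by
      rw [norm_pow]; exact pow_lt_one₀ (norm_nonneg x) hx (by omega)
    rw [← sub_eq_zero.1 h0] at this
    simp at this
  simp only [Function.comp]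
  rw [mul_neg, Complex.exp_neg]
  congr 1
  rw [show ((j : ℂ) + 1) = ((j + 1 : ℕ) : ℂ) by push_cast; rfl, Complex.exp_nat_mul,
    Complex.exp_log hj]

lemma Q_eventuallyEq_exp {x : ℂ} (hx : ‖x‖ < 1) :
    Q =ᶠ[𝓝 x] fun y => Complex.exp (logSeries 0 y) := by
  filter_upwards [Metric.isOpen_ball.mem_nhds (by simpa using hx : x ∈ Metric.ball (0 : ℂ) 1)]
    with y hy
  exact Q_eq_exp (by simpa using hy)

lemma differentiableAt_Q {x : ℂ} (hx : ‖x‖ < 1) : DifferentiableAt ℂ Q x := by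
  exact (logSeries_differentiableAt_and_mul_deriv 0 hx).1.cexp.congr_of_eventuallyEq
    (Q_eventuallyEq_exp hx)

lemma Q_ne_zero {x : ℂ} (hx : ‖x‖ < 1) : Q x ≠ 0 := by
  rw [Q_eq_exp hx]; exact Complex.exp_ne_zero _

lemma deriv_Q {x : ℂ} (hx : ‖x‖ < 1) : deriv Q x = Q x * deriv (logSeries 0) x := by
  rw [(Q_eventuallyEq_exp hx).deriv_eq,
    deriv_cexp (logSeries_differentiableAt_and_mul_deriv 0 hx).1, Q_eq_exp hx]

lemma mul_deriv_Q {x : ℂ} (hx : ‖x‖ < 1) : x * deriv Q x = Q x * logSeries 1 x := by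
  rw [deriv_Q hx, ← (logSeries_differentiableAt_and_mul_deriv 0 hx).2]; ring

lemma haymanA_Q {r : ℝ} (h0 : 0 ≤ r) (h1 : r < 1) : haymanA Q r = logSeriesReal 1 r := by
  have hx : ‖(r : ℂ)‖ < 1 := by rwa [Complex.norm_real, Real.norm_of_nonneg h0]
  rw [haymanA, mul_deriv_Q hx, mul_div_cancel_left₀ _ (Q_ne_zero hx), logSeries_ofReal,
    Complex.ofReal_re]

lemma haymanB_Q {r : ℝ} (h0 : 0 ≤ r) (h1 : r < 1) : haymanB Q r = logSeriesReal 2 r := by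
  have hx : ‖(r : ℂ)‖ < 1 := by rwa [Complex.norm_real, Real.norm_of_nonneg h0]
  have hQ := Q_ne_zero hx
  have hA : DifferentiableOn ℂ Q (Metric.ball 0 1) := fun y hy =>
    (differentiableAt_Q (by simpa using hy)).differentiableWithinAt
  have hd : DifferentiableAt ℂ (deriv Q) r :=
    (hA.deriv Metric.isOpen_ball).differentiableAt
      (Metric.isOpen_ball.mem_nhds (by simpa using hx))
  -- differentiate `x Q' = Q · logSeries 1`
  have h : (fun y => y * deriv Q y) =ᶠ[𝓝 (r : ℂ)] fun y => Q y * logSeries 1 y := by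
    filter_upwards [Metric.isOpen_ball.mem_nhds
      (by simpa using hx : (r : ℂ) ∈ Metric.ball (0 : ℂ) 1)] with y hy
    exact mul_deriv_Q (by simpa using hy)
  have h2 := h.deriv_eq
  rw [deriv_fun_mul differentiableAt_fun_id hd,
    deriv_fun_mul (differentiableAt_Q hx) (logSeries_differentiableAt_and_mul_deriv 1 hx).1] at h2
  simp only [deriv_id'', one_mul] at h2
  have h3 := mul_deriv_Q hx
  have h4 := (logSeries_differentiableAt_and_mul_deriv 1 hx).2
  have key : (r : ℂ) * deriv Q r / Q r + (r : ℂ) ^ 2 * deriv (deriv Q) r / Q r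
      - (r : ℂ) ^ 2 * (deriv Q r / Q r) ^ 2 = logSeries 2 r := by
    rw [show (2 : ℕ) = 1 + 1 from rfl, ← h4]
    have hq : (r : ℂ) * deriv Q r / Q r + (r : ℂ) ^ 2 * deriv (deriv Q) r / Q r
        - (r : ℂ) ^ 2 * (deriv Q r / Q r) ^ 2
        = (r * deriv Q r * Q r + (r : ℂ) ^ 2 * deriv (deriv Q) r * Q r
          - (r : ℂ) ^ 2 * deriv Q r ^ 2) / Q r ^ 2 := by field_simp
    rw [hq, div_eq_iff (pow_ne_zero 2 hQ)]
    linear_combination Q r * r * h2 - (r * deriv Q r) * h3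
  rw [haymanB, key, logSeries_ofReal, Complex.ofReal_re]

/-! ### Size of the logarithmic derivatives near `r = 1` -/

lemma summable_one_div_succ_pow {p : ℕ} (hp : 1 < p) :
    Summable fun n : ℕ => 1 / ((n : ℝ) + 1) ^ p := by
  have := (summable_nat_add_iff 1).2 (Real.summable_one_div_nat_pow.2 hp)
  simpa using this

/-- `ζ(3)` as a real number. -/
noncomputable def zetaThree : ℝ := ∑' n : ℕ, 1 / ((n : ℝ) + 1) ^ 3

lemma riemannZeta_three_re : (riemannZeta 3).re = zetaThree := by
  have h := zeta_nat_eq_tsum_of_gt_one (k := 3) (by norm_num)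
  have h2 : (∑' n : ℕ, 1 / (n : ℂ) ^ 3) = ((∑' n : ℕ, 1 / (n : ℝ) ^ 3 : ℝ) : ℂ) := by
    push_cast; rfl
  rw [show (3 : ℂ) = ((3 : ℕ) : ℂ) by norm_num, h, h2, Complex.ofReal_re, zetaThree,
    (Real.summable_one_div_nat_pow.2 (by norm_num : 1 < 3)).tsum_eq_zero_add]
  simp

lemma zetaThree_pos : 0 < zetaThree :=
  (summable_one_div_succ_pow (by norm_num)).tsum_pos (fun n => by positivity) 0 (by norm_num)

lemma zetaThree_le : zetaThree ≤ 2 := by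
  have h2 : ∑' n : ℕ, 1 / ((n : ℝ) + 1) ^ 2 = Real.pi ^ 2 / 6 := by
    rw [← hasSum_zeta_two.tsum_eq,
      (Real.summable_one_div_nat_pow.2 (by norm_num : 1 < 2)).tsum_eq_zero_add]
    simp
  have h3 : zetaThree ≤ ∑' n : ℕ, 1 / ((n : ℝ) + 1) ^ 2 := by
    refine (summable_one_div_succ_pow (by norm_num)).tsum_le_tsum (fun n => ?_)
      (summable_one_div_succ_pow (by norm_num))
    have : (1 : ℝ) ≤ n + 1 := by simp
    gcongr
    norm_num
  have := Real.pi_lt_d2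
  have := Real.pi_pos
  nlinarith

lemma choose_add_le_pow (j p : ℕ) : (j + p).choose p ≤ (j + 1) ^ p := by
  induction p with
  | zero => simp
  | succ p ih =>
    have h := Nat.add_one_mul_choose_eq (j + p) p
    have h2 : (j + p + 1) ≤ (j + 1) * (p + 1) := by nlinarith [Nat.zero_le (j * p)]
    refine Nat.le_of_mul_le_mul_right (c := p + 1) ?_ (by omega)
    rw [← add_assoc, ← h, pow_succ]
    calc (j + p + 1) * (j + p).choose p ≤ ((j + 1) * (p + 1)) * (j + 1) ^ p := by gcongr
      _ = _ := by ring

lemma hasSum_succ_mul_pow {𝕜 : Type*} [RCLike 𝕜] {y : 𝕜} (hy : ‖y‖ < 1) :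
    HasSum (fun j : ℕ => ((j : 𝕜) + 1) * y ^ (j + 1)) (y / (1 - y) ^ 2) := by
  have h := (hasSum_choose_mul_geometric_of_norm_lt_one 1 hy).mul_left y
  rw [mul_one_div] at h
  refine h.congr_fun fun j => ?_
  rw [Nat.choose_one_right]
  push_cast
  ring

lemma hasSum_succ_sq_mul_pow {y : ℝ} (hy : ‖y‖ < 1) :
    HasSum (fun j : ℕ => ((j : ℝ) + 1) ^ 2 * y ^ (j + 1)) (y * (1 + y) / (1 - y) ^ 3) := by
  have h := ((hasSum_choose_mul_geometric_of_norm_lt_one 2 hy).mul_left (2 * y)).sub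
    (hasSum_succ_mul_pow hy)
  have h1 : 1 - y ≠ 0 := by
    have := (abs_lt.1 hy).2
    exact (sub_pos.2 this).ne'
  have h2 : 2 * y * (1 / (1 - y) ^ (2 + 1)) - y / (1 - y) ^ 2 = y * (1 + y) / (1 - y) ^ 3 := by
    field_simp; ring
  rw [h2] at h
  refine h.congr_fun fun j => ?_
  have h3 := Nat.cast_choose_two ℝ (j + 2)
  rw [h3]
  push_cast
  ring

/-- Summing the double series over `j` first. -/
lemma hasSum_logSeriesReal (s : ℕ) {r : ℝ} (h0 : 0 ≤ r) (h1 : r < 1) {g : ℕ → ℝ}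
    (hg : ∀ k, HasSum (fun j : ℕ => ((j : ℝ) + 1) ^ (s + 1) * (r ^ (k + 1)) ^ (j + 1)) (g k)) :
    HasSum (fun k : ℕ => ((k : ℝ) + 1) ^ s / (k + 1) * g k) (logSeriesReal s r) := by
  have h := (Equiv.prodComm ℕ ℕ).hasSum_iff.2 (summable_coef_mul_pow s h0 h1).hasSum
  refine h.prod_fiberwise fun k => ?_
  refine ((hg k).mul_left (((k : ℝ) + 1) ^ s / (k + 1))).congr_fun fun j => ?_
  simp only [Function.comp, Equiv.prodComm_apply, Prod.swap, coef, expo]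
  push_cast
  rw [← pow_mul, mul_pow, mul_comm (j + 1) (k + 1), pow_succ ((j : ℝ) + 1) s]
  field_simp

lemma mul_exp_neg_half_le {t : ℝ} (ht : 0 ≤ t) :
    t * Real.exp (-(t / 2)) ≤ 1 - Real.exp (-t) := by
  have h := Real.self_le_sinh_iff.2 (by positivity : 0 ≤ t / 2)
  rw [Real.sinh_eq] at h
  have h2 : Real.exp (-t) = Real.exp (-(t / 2)) * Real.exp (-(t / 2)) := by
    rw [← Real.exp_add]; ring_nf
  have h3 : Real.exp (t / 2) * Real.exp (-(t / 2)) = 1 := by rw [← Real.exp_add]; simp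
  have := Real.exp_pos (-(t / 2))
  nlinarith

lemma exp_neg_succ (d : ℝ) (k : ℕ) :
    Real.exp (-d) ^ (k + 1) = Real.exp (-(((k : ℝ) + 1) * d)) := by
  rw [← Real.exp_nat_mul]; push_cast; ring_nf

lemma logSeriesReal_zero_le {d : ℝ} (hd : 0 < d) :
    logSeriesReal 0 (Real.exp (-d)) ≤ 2 / d ^ 2 := by
  have hr : Real.exp (-d) < 1 := by rw [Real.exp_lt_one_iff]; linarith
  have hy : ∀ k : ℕ, ‖Real.exp (-d) ^ (k + 1)‖ < 1 := fun k => by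
    rw [norm_pow, Real.norm_of_nonneg (Real.exp_pos _).le]
    exact pow_lt_one₀ (Real.exp_pos _).le hr (by omega)
  have h := hasSum_logSeriesReal 0 (Real.exp_pos (-d)).le hr fun k => by
    simpa using hasSum_succ_mul_pow (hy k)
  have h2 : HasSum (fun k : ℕ => 1 / ((k : ℝ) + 1) ^ 3 * (1 / d ^ 2)) (zetaThree * (1 / d ^ 2)) :=
    (summable_one_div_succ_pow (by norm_num)).hasSum.mul_right _
  refine (hasSum_le (fun k => ?_) h h2).trans ?_
  · have hk : (0 : ℝ) < k + 1 := by positivity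
    rw [exp_neg_succ]
    set t := ((k : ℝ) + 1) * d with ht
    have ht0 : 0 < t := by positivity
    have h3 := mul_exp_neg_half_le ht0.le
    have h4 : 0 < 1 - Real.exp (-t) := by
      have : Real.exp (-t) < 1 := by rw [Real.exp_lt_one_iff]; linarith
      linarith
    have h5 : Real.exp (-t) / (1 - Real.exp (-t)) ^ 2 ≤ 1 / t ^ 2 := by
      rw [div_le_div_iff₀ (by positivity) (by positivity), one_mul]
      calc Real.exp (-t) * t ^ 2 = (t * Real.exp (-(t / 2))) ^ 2 := by
            have h6 : Real.exp (-t) = Real.exp (-(t / 2)) ^ 2 := by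
              rw [← Real.exp_nat_mul]; ring_nf
            rw [h6]; ring
        _ ≤ _ := by gcongr
    calc ((k : ℝ) + 1) ^ 0 / (k + 1) * (Real.exp (-t) / (1 - Real.exp (-t)) ^ 2)
        ≤ ((k : ℝ) + 1) ^ 0 / (k + 1) * (1 / t ^ 2) := by gcongr
      _ = _ := by rw [ht]; field_simp
  · have := zetaThree_le
    rw [mul_one_div]
    gcongr

/-- The bound for `s = 0` at `d / 2` controls all `s`, since
`m ^ s e ^ (-m d / 2) ≤ s! (2 / d) ^ s`. -/
lemma logSeriesReal_le (s : ℕ) {d : ℝ} (hd : 0 < d) :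
    logSeriesReal s (Real.exp (-d)) ≤ s.factorial * (2 / d) ^ s * (8 / d ^ 2) := by
  have hr : Real.exp (-d) < 1 := by rw [Real.exp_lt_one_iff]; linarith
  have hr2 : Real.exp (-(d / 2)) < 1 := by rw [Real.exp_lt_one_iff]; linarith
  have h1 := (summable_coef_mul_pow s (Real.exp_pos (-d)).le hr).hasSum
  have h2 := (summable_coef_mul_pow 0 (Real.exp_pos (-(d / 2))).le hr2).hasSum.mul_left
    (s.factorial * (2 / d) ^ s)
  refine (hasSum_le (fun p => ?_) h1 h2).trans ?_
  · have h3 := Real.pow_div_factorial_le_exp (expo p * (d / 2)) (by positivity) s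
    have h4 : coef s p = coef 0 p * (expo p : ℝ) ^ s := by unfold coef; ring
    have h5 : Real.exp (-d) ^ expo p
        = Real.exp (-(d / 2)) ^ expo p * Real.exp (-(expo p * (d / 2))) := by
      rw [← Real.exp_nat_mul, ← Real.exp_nat_mul, ← Real.exp_add]; ring_nf
    have h6 : (expo p : ℝ) ^ s * Real.exp (-(expo p * (d / 2))) ≤ s.factorial * (2 / d) ^ s := by
      rw [Real.exp_neg, ← div_eq_mul_inv, div_le_iff₀ (Real.exp_pos _)]
      rw [div_le_iff₀ (by positivity), mul_pow] at h3
      have h7 : (2 / d) ^ s * (d / 2) ^ s = 1 := by rw [← mul_pow]; field_simp; simp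
      calc (expo p : ℝ) ^ s = (2 / d) ^ s * ((expo p : ℝ) ^ s * (d / 2) ^ s) := by
            linear_combination (-(expo p : ℝ) ^ s) * h7
        _ ≤ (2 / d) ^ s * (Real.exp (expo p * (d / 2)) * s.factorial) := by gcongr
        _ = _ := by ring
    have := coef_pos 0 p
    calc coef s p * Real.exp (-d) ^ expo p
        = ((expo p : ℝ) ^ s * Real.exp (-(expo p * (d / 2)))) *
          (coef 0 p * Real.exp (-(d / 2)) ^ expo p) := by rw [h4, h5]; ring
      _ ≤ _ := by gcongr
  · have h3 := logSeriesReal_zero_le (half_pos hd)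
    have h4 : 2 / (d / 2) ^ 2 = 8 / d ^ 2 := by field_simp; norm_num
    rw [h4] at h3
    change _ * logSeriesReal 0 _ ≤ _
    gcongr

lemma injective_pair_zero : Function.Injective fun j : ℕ => (j, 0) := fun a b h => by
  simpa using h

/-- The terms with `k = 1` alone have the right order of magnitude. -/
lemma le_logSeriesReal (s : ℕ) {r : ℝ} (h0 : 0 < r) (h1 : r < 1) :
    r / (-Real.log r) ^ (s + 2) ≤ logSeriesReal s r := by
  have hs := summable_coef_mul_pow s h0.le h1
  have h2 := tsum_comp_le_tsum_of_inj hs (fun p => mul_nonneg (coef_pos s p).le (by positivity))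
    injective_pair_zero
  refine le_trans ?_ h2
  have hn : ‖r‖ < 1 := by rwa [Real.norm_of_nonneg h0.le]
  have h3 := (hasSum_choose_mul_geometric_of_norm_lt_one (s + 1) hn).mul_left r
  have h4 := hasSum_le (fun j => ?_) h3 (hs.comp_injective injective_pair_zero).hasSum
  · refine le_trans ?_ h4
    have h5 : 0 < 1 - r := by linarith
    have h6 : 1 - r ≤ -Real.log r := by linarith [Real.log_le_sub_one_of_pos h0]
    rw [mul_one_div]
    gcongr
  · have h7 : (((j + (s + 1)).choose (s + 1) : ℕ) : ℝ) ≤ ((j : ℝ) + 1) ^ (s + 1) := by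
      exact_mod_cast choose_add_le_pow j (s + 1)
    simp only [Function.comp, coef, expo]
    push_cast
    simp only [zero_add, mul_one, div_one]
    calc r * (((j + (s + 1)).choose (s + 1) : ℕ) * r ^ j)
        ≤ r * (((j : ℝ) + 1) ^ (s + 1) * r ^ j) := by gcongr
      _ = _ := by ring

/-- On a circle, `log |Q|` drops from its value on the positive axis at least as much as the `k = 1`
part of the double series does. -/
lemma re_logSeries_le {x : ℂ} (hx : ‖x‖ < 1) :
    (logSeries 0 x).re ≤ logSeriesReal 0 ‖x‖ - (‖x‖ / (1 - ‖x‖) ^ 2 - ‖x‖ / ‖1 - x‖ ^ 2) := by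
  have hr := summable_coef_mul_pow 0 (norm_nonneg x) hx
  have hc := Complex.hasSum_re (summable_logSeries 0 hx).hasSum
  have hd := hr.hasSum.sub hc
  have hnn : ∀ p, 0 ≤ coef 0 p * ‖x‖ ^ expo p - ((coef 0 p : ℂ) * x ^ expo p).re := fun p => by
    have := Complex.re_le_norm ((coef 0 p : ℂ) * x ^ expo p)
    rw [norm_coef_mul_pow] at this
    linarith
  have h2 := tsum_comp_le_tsum_of_inj hd.summable hnn injective_pair_zero
  rw [hd.tsum_eq] at h2
  have h3 := (hasSum_succ_mul_pow (y := ‖x‖) (by simpa using hx)).sub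
    (Complex.hasSum_re (hasSum_succ_mul_pow hx))
  have h4 : (fun j : ℕ => ((j : ℝ) + 1) * ‖x‖ ^ (j + 1) - (((j : ℂ) + 1) * x ^ (j + 1)).re)
      = fun j : ℕ => coef 0 (j, 0) * ‖x‖ ^ expo (j, 0)
        - ((coef 0 (j, 0) : ℂ) * x ^ expo (j, 0)).re := by
    ext j; simp [coef, expo]
  rw [h4] at h3
  simp only [Function.comp_def] at h2
  rw [h3.tsum_eq] at h2
  have h5 := Complex.re_le_norm (x / (1 - x) ^ 2)
  rw [norm_div, norm_pow] at h5
  change _ ≤ logSeriesReal 0 ‖x‖ - (logSeries 0 x).re at h2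
  linarith

/-! ### The first-order asymptotics of `a(r)` -/

lemma sinh_le_mul_cosh {s : ℝ} (hs : 0 ≤ s) : Real.sinh s ≤ s * Real.cosh s := by
  have h : MonotoneOn (fun x => x * Real.cosh x - Real.sinh x) (Set.Ici 0) := by
    refine monotoneOn_of_deriv_nonneg (convex_Ici 0) (by fun_prop) (by fun_prop) fun x hx => ?_
    rw [interior_Ici, Set.mem_Ioi] at hx
    have h1 : HasDerivAt (fun x => x * Real.cosh x - Real.sinh x)
        (1 * Real.cosh x + x * Real.sinh x - Real.cosh x) x :=
      ((hasDerivAt_id x).mul (Real.hasDerivAt_cosh x)).sub (Real.hasDerivAt_sinh x)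
    rw [h1.deriv]
    have := Real.sinh_pos_iff.2 hx
    nlinarith [mul_pos hx this]
  have := h Set.self_mem_Ici hs hs
  simp at this
  linarith

/-- `∑ j² e^(-j t)` in terms of hyperbolic functions of `t / 2`. -/
lemma sum_sq_eq_hyperbolic {t : ℝ} (ht : 0 < t) :
    Real.exp (-t) * (1 + Real.exp (-t)) / (1 - Real.exp (-t)) ^ 3
      = 2 * Real.cosh (t / 2) / (2 * Real.sinh (t / 2)) ^ 3 := by
  have h1 : 0 < 1 - Real.exp (-t) := by
    have : Real.exp (-t) < 1 := by rw [Real.exp_lt_one_iff]; linarith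
    linarith
  have h2 : 0 < Real.sinh (t / 2) := Real.sinh_pos_iff.2 (by positivity)
  rw [div_eq_div_iff (by positivity) (by positivity), Real.cosh_eq, Real.sinh_eq,
    Real.exp_neg (t / 2)]
  have h3 : Real.exp (-t) = (Real.exp (t / 2))⁻¹ ^ 2 := by
    rw [← Real.exp_neg, ← Real.exp_nat_mul]; ring_nf
  rw [h3]
  have := Real.exp_pos (t / 2)
  field_simp

/-- The difference is `O(1 / t)` for `t ≤ 1` and `O(1 / t³)` for `t ≥ 1`; the power `t ^ (-3/2)`
lies above both. -/
lemma abs_sum_sq_sub_le {t : ℝ} (ht : 0 < t) :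
    |Real.exp (-t) * (1 + Real.exp (-t)) / (1 - Real.exp (-t)) ^ 3 - 2 / t ^ 3|
      ≤ 96 * t ^ (-(3 / 2) : ℝ) := by
  have hx1 : Real.exp (-t) < 1 := by rw [Real.exp_lt_one_iff]; linarith
  have hx0 := Real.exp_pos (-t)
  have h1x : 0 < 1 - Real.exp (-t) := by linarith
  have hsq : 0 < √t := Real.sqrt_pos.2 ht
  have hpow : t ^ (-(3 / 2) : ℝ) = 1 / (t * √t) := by
    rw [Real.rpow_neg ht.le, show (3 / 2 : ℝ) = 1 + 1 / 2 by norm_num, Real.rpow_add ht,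
      Real.rpow_one, ← Real.sqrt_eq_rpow, one_div]
  rw [hpow]
  rcases le_total t 1 with h | h
  · have hb : 1 / t ≤ 1 / (t * √t) := by
      have : √t ≤ 1 := Real.sqrt_le_one.2 h
      exact one_div_le_one_div_of_le (by positivity) (by nlinarith)
    rw [sum_sq_eq_hyperbolic ht]
    set s := t / 2 with hs
    have hs0 : 0 < s := by positivity
    have hts : t = 2 * s := by rw [hs]; ring
    have hS : 0 < Real.sinh s := Real.sinh_pos_iff.2 hs0
    have hC : 0 < Real.cosh s := Real.cosh_pos s
    have hS1 : s ≤ Real.sinh s := Real.self_le_sinh_iff.2 hs0.le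
    have hS2 := sinh_le_mul_cosh hs0.le
    have hC1 : Real.cosh s ≤ 1 + s ^ 2 := by
      refine (Real.cosh_le_exp_half_sq s).trans ?_
      have := Real.abs_exp_sub_one_le (x := s ^ 2 / 2) (by
        rw [abs_of_nonneg (by positivity)]; nlinarith)
      rw [abs_of_nonneg (a := s ^ 2 / 2) (by positivity)] at this
      linarith [(abs_le.1 this).2]
    have hup : 2 * Real.cosh s / (2 * Real.sinh s) ^ 3 ≤ 2 * (1 + s ^ 2) / t ^ 3 := by
      rw [hts]; gcongr
    have hlo : 2 * (1 - s ^ 2) / t ^ 3 ≤ 2 * Real.cosh s / (2 * Real.sinh s) ^ 3 := by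
      have h1 : (1 - s ^ 2) * Real.cosh s ^ 2 ≤ 1 := by
        have := Real.cosh_sq s
        have : Real.sinh s ^ 2 ≤ (s * Real.cosh s) ^ 2 := by gcongr
        nlinarith
      rw [div_le_div_iff₀ (by positivity) (by positivity), hts]
      have hs1 : 0 ≤ 1 - s ^ 2 := by nlinarith
      calc 2 * (1 - s ^ 2) * (2 * Real.sinh s) ^ 3
          ≤ 2 * (1 - s ^ 2) * (2 * (s * Real.cosh s)) ^ 3 := by gcongr
        _ = ((1 - s ^ 2) * Real.cosh s ^ 2) * (2 * Real.cosh s * (2 * s) ^ 3) := by ring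
        _ ≤ 1 * (2 * Real.cosh s * (2 * s) ^ 3) := by gcongr
        _ = _ := by ring
    have e1 : 2 * (1 + s ^ 2) / t ^ 3 = 2 / t ^ 3 + 1 / 2 * (1 / t) := by rw [hs]; field_simp
    have e2 : 2 * (1 - s ^ 2) / t ^ 3 = 2 / t ^ 3 - 1 / 2 * (1 / t) := by rw [hs]; field_simp
    have : 0 < 1 / t := by positivity
    rw [abs_le]
    constructor <;> linarith
  · have hb : 1 / t ^ 3 ≤ 1 / (t * √t) := by
      have : √t ≤ t := Real.sqrt_le_iff.2 ⟨ht.le, by nlinarith⟩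
      refine one_div_le_one_div_of_le (by positivity) ?_
      calc t * √t ≤ t * t := by gcongr
        _ ≤ t * t * t := le_mul_of_one_le_right (by positivity) h
        _ = t ^ 3 := by ring
    have h6 : Real.exp (-t) ≤ 6 * (1 / t ^ 3) := by
      have := Real.pow_div_factorial_le_exp t ht.le 3
      rw [Real.exp_neg, mul_one_div, inv_eq_one_div,
        div_le_div_iff₀ (Real.exp_pos _) (by positivity)]
      norm_num [Nat.factorial] at this
      linarith
    have h7 : Real.exp (-t) ≤ 1 / 2 := by
      have : Real.exp (-t) ≤ Real.exp (-1) := Real.exp_le_exp.2 (by linarith)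
      have := Real.exp_neg_one_lt_d9
      linarith
    have hup : Real.exp (-t) * (1 + Real.exp (-t)) / (1 - Real.exp (-t)) ^ 3
        ≤ 16 * Real.exp (-t) := by
      rw [div_le_iff₀ (by positivity)]
      have h8 : (1 / 2 : ℝ) ^ 3 ≤ (1 - Real.exp (-t)) ^ 3 := by gcongr; linarith
      nlinarith
    have hlo : 0 ≤ Real.exp (-t) * (1 + Real.exp (-t)) / (1 - Real.exp (-t)) ^ 3 := by positivity
    have e : 2 / t ^ 3 = 2 * (1 / t ^ 3) := by ring
    have : 0 < 1 / t ^ 3 := by positivity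
    rw [abs_le, e]
    constructor <;> linarith

/-- `a(e^(-d)) = 2 ζ(3) / d³ + O(d^(-3/2))`. The true error is `O(1 / d)`, but any exponent below
`5/3` suffices for locating `r_n`, and `3/2` makes the sum over `k` of the error terms converge. -/
lemma exists_abs_logSeriesReal_one_sub_le : ∃ C : ℝ, 0 < C ∧ ∀ d : ℝ, 0 < d →
    |logSeriesReal 1 (Real.exp (-d)) - 2 * zetaThree / d ^ 3| ≤ C * d ^ (-(3 / 2) : ℝ) := by
  have hsum : Summable fun k : ℕ => ((k : ℝ) + 1) ^ (-(3 / 2) : ℝ) := by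
    have := (summable_nat_add_iff 1).2
      (Real.summable_nat_rpow.2 (by norm_num : (-(3 / 2) : ℝ) < -1))
    simpa using this
  refine ⟨96 * ∑' k : ℕ, ((k : ℝ) + 1) ^ (-(3 / 2) : ℝ), ?_, fun d hd => ?_⟩
  · have := hsum.tsum_pos (fun k => by positivity) 0 (by norm_num)
    positivity
  have hr : Real.exp (-d) < 1 := by rw [Real.exp_lt_one_iff]; linarith
  have hy : ∀ k : ℕ, ‖Real.exp (-d) ^ (k + 1)‖ < 1 := fun k => by
    rw [norm_pow, Real.norm_of_nonneg (Real.exp_pos _).le]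
    exact pow_lt_one₀ (Real.exp_pos _).le hr (by omega)
  have h := hasSum_logSeriesReal 1 (Real.exp_pos (-d)).le hr fun k => hasSum_succ_sq_mul_pow (hy k)
  have h2 : HasSum (fun k : ℕ => 1 / ((k : ℝ) + 1) ^ 3 * (2 / d ^ 3)) (zetaThree * (2 / d ^ 3)) :=
    (summable_one_div_succ_pow (by norm_num)).hasSum.mul_right _
  have h3 := h.sub h2
  have h4 := hsum.hasSum.mul_right (96 * d ^ (-(3 / 2) : ℝ))
  have h5 := tsum_of_norm_bounded h4 (f := fun k : ℕ => ((k : ℝ) + 1) ^ 1 / (k + 1) *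
    (Real.exp (-d) ^ (k + 1) * (1 + Real.exp (-d) ^ (k + 1)) / (1 - Real.exp (-d) ^ (k + 1)) ^ 3)
    - 1 / ((k : ℝ) + 1) ^ 3 * (2 / d ^ 3)) fun k => by
      have hk : (0 : ℝ) < k + 1 := by positivity
      have h6 := abs_sum_sq_sub_le (t := ((k : ℝ) + 1) * d) (by positivity)
      rw [← exp_neg_succ, Real.mul_rpow hk.le hd.le] at h6
      rw [pow_one, div_self hk.ne', one_mul, Real.norm_eq_abs]
      refine le_trans (le_of_eq ?_) (h6.trans (le_of_eq ?_))
      · congr 1; field_simp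
      · ring
  rw [h3.tsum_eq, Real.norm_eq_abs] at h5
  refine le_trans (le_of_eq ?_) (h5.trans (le_of_eq ?_))
  · congr 1; ring
  · ring

/-! ### Major and minor arcs, and admissibility -/

lemma norm_exp_I_sub_taylor_le (y : ℝ) :
    ‖Complex.exp (Complex.I * y) - 1 - Complex.I * y + (y : ℂ) ^ 2 / 2‖ ≤ 4 * |y| ^ 3 := by
  have hI : ‖Complex.I * (y : ℂ)‖ = |y| := by simp
  have hrw : Complex.exp (Complex.I * y) - 1 - Complex.I * y + (y : ℂ) ^ 2 / 2
      = Complex.exp (Complex.I * y)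
        - ∑ m ∈ Finset.range 3, (Complex.I * (y : ℂ)) ^ m / m.factorial := by
    simp [Finset.sum_range_succ, mul_pow]
    ring
  rw [hrw]
  rcases le_total |y| 1 with h | h
  · refine (Complex.norm_exp_sub_sum_le_norm_mul_exp _ 3).trans ?_
    rw [hI, mul_comm]
    have : Real.exp |y| ≤ Real.exp 1 := Real.exp_le_exp.2 h
    have := Real.exp_one_lt_d9
    gcongr
    linarith
  · have h1 : ‖Complex.exp (Complex.I * y)‖ = 1 := by
      rw [mul_comm]; exact Complex.norm_exp_ofReal_mul_I y
    have h2 : ‖∑ m ∈ Finset.range 3, (Complex.I * (y : ℂ)) ^ m / m.factorial‖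
        ≤ 1 + |y| + |y| ^ 2 / 2 := by
      refine (norm_sum_le _ _).trans (le_of_eq ?_)
      simp [Finset.sum_range_succ]
    refine (norm_sub_le _ _).trans ?_
    rw [h1]
    nlinarith [mul_nonneg (sub_nonneg.2 h) (abs_nonneg y),
      mul_nonneg (sub_nonneg.2 h) (sq_nonneg |y|)]

lemma polar_pow (r θ : ℝ) (m : ℕ) :
    polar r θ ^ m = (r : ℂ) ^ m * Complex.exp (Complex.I * ((m * θ : ℝ) : ℂ)) := by
  rw [polar, mul_pow, ← Complex.exp_nat_mul]
  congr 2
  push_cast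
  ring

lemma norm_polar {r : ℝ} (hr : 0 ≤ r) (θ : ℝ) : ‖polar r θ‖ = r := by
  rw [polar, norm_mul, mul_comm Complex.I, Complex.norm_exp_ofReal_mul_I, mul_one,
    Complex.norm_real, Real.norm_of_nonneg hr]

/-- Third-order Taylor expansion of `log Q` along a circle; since all coefficients are nonnegative,
the error is controlled by the value at the real point. -/
lemma norm_logSeries_polar_sub_le {r : ℝ} (h0 : 0 ≤ r) (h1 : r < 1) (θ : ℝ) :
    ‖logSeries 0 (polar r θ) - logSeriesReal 0 r
      - (Complex.I * θ * logSeriesReal 1 r - (θ : ℂ) ^ 2 * logSeriesReal 2 r / 2)‖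
      ≤ 4 * |θ| ^ 3 * logSeriesReal 3 r := by
  have hn : ‖polar r θ‖ < 1 := by rwa [norm_polar h0]
  have hr : ‖(r : ℂ)‖ < 1 := by rwa [Complex.norm_real, Real.norm_of_nonneg h0]
  have s (i : ℕ) : HasSum (fun p => (coef i p : ℂ) * (r : ℂ) ^ expo p) (logSeries i r) :=
    (summable_logSeries i hr).hasSum
  have h := ((summable_logSeries 0 hn).hasSum.sub (s 0)).sub
    (((s 1).mul_left (Complex.I * θ)).sub (((s 2).mul_left ((θ : ℂ) ^ 2)).div_const 2))
  have hb := (summable_coef_mul_pow 3 h0 h1).hasSum.mul_left (4 * |θ| ^ 3)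
  simp only [← logSeries_ofReal]
  change ‖tsum (fun p => (coef 0 p : ℂ) * polar r θ ^ expo p) - _ - _‖ ≤ _
  rw [← h.tsum_eq]
  refine tsum_of_norm_bounded hb fun p => ?_
  have hm : (0 : ℝ) ≤ expo p := by positivity
  have hc := (coef_pos 0 p).le
  have h2 := norm_exp_I_sub_taylor_le (expo p * θ)
  have hrm : 0 ≤ r ^ expo p := by positivity
  have e : (coef 0 p : ℂ) * polar r θ ^ expo p - (coef 0 p : ℂ) * (r : ℂ) ^ expo p
      - (Complex.I * θ * ((coef 1 p : ℂ) * (r : ℂ) ^ expo p)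
        - (θ : ℂ) ^ 2 * ((coef 2 p : ℂ) * (r : ℂ) ^ expo p) / 2)
      = ((coef 0 p * r ^ expo p : ℝ) : ℂ) * (Complex.exp (Complex.I * ((expo p * θ : ℝ) : ℂ)) - 1
        - Complex.I * ((expo p * θ : ℝ) : ℂ) + ((expo p * θ : ℝ) : ℂ) ^ 2 / 2) := by
    rw [polar_pow, coef_succ 1, coef_succ 0]
    push_cast
    ring
  rw [e, norm_mul, Complex.norm_real, Real.norm_of_nonneg (by positivity)]
  calc coef 0 p * r ^ expo p * _ ≤ coef 0 p * r ^ expo p * (4 * |expo p * θ| ^ 3) := by gcongr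
    _ = _ := by
      rw [abs_mul, abs_of_nonneg hm, coef_succ 2, coef_succ 1, coef_succ 0]; ring

lemma Q_ofReal {r : ℝ} (h0 : 0 ≤ r) (h1 : r < 1) :
    Q r = (Real.exp (logSeriesReal 0 r) : ℂ) := by
  rw [Q_eq_exp (by rwa [Complex.norm_real, Real.norm_of_nonneg h0]), logSeries_ofReal,
    Complex.ofReal_exp]

lemma norm_Q_ofReal {r : ℝ} (h0 : 0 ≤ r) (h1 : r < 1) :
    ‖Q r‖ = Real.exp (logSeriesReal 0 r) := by
  rw [Q_ofReal h0 h1, Complex.norm_real, Real.norm_of_nonneg (Real.exp_pos _).le]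

lemma norm_one_sub_polar_sq (r θ : ℝ) :
    ‖1 - polar r θ‖ ^ 2 = (1 - r) ^ 2 + 2 * r * (1 - Real.cos θ) := by
  rw [← Complex.normSq_eq_norm_sq, Complex.normSq_apply, polar, mul_comm Complex.I,
    Complex.exp_mul_I]
  simp [Complex.cos_ofReal_re, Complex.sin_ofReal_re, Complex.cos_ofReal_im, Complex.sin_ofReal_im]
  linear_combination r ^ 2 * Real.sin_sq_add_cos_sq θ

/-- Saving on the minor arcs: `r / (1 - r)² - r / |1 - x|²` on `|x| = r`, `|θ| ≥ δ` is
smallest at `|θ| = δ`, where it is at least `δ² / (20 d⁴)`. -/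
lemma norm_Q_polar_le {r δ θ : ℝ} (hr : 1 / 2 ≤ r) (h1 : r < 1) (hδ : 0 ≤ δ)
    (hδd : δ ≤ -Real.log r) (hθ : δ ≤ |θ|) (hπ : |θ| ≤ Real.pi) :
    ‖Q (polar r θ)‖ ≤ ‖Q r‖ * Real.exp (-(δ ^ 2 / (20 * (-Real.log r) ^ 4))) := by
  have h0 : 0 < r := by linarith
  have hn : ‖polar r θ‖ = r := norm_polar h0.le θ
  rw [norm_Q_ofReal h0.le h1, Q_eq_exp (by rwa [hn]), Complex.norm_exp, ← Real.exp_add,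
    Real.exp_le_exp]
  have h := re_logSeries_le (x := polar r θ) (by rwa [hn])
  rw [hn, norm_one_sub_polar_sq] at h
  set d := -Real.log r with hd
  have hsd : 1 - r ≤ d := by rw [hd]; linarith [Real.log_le_sub_one_of_pos h0]
  have hs : 0 < 1 - r := by linarith
  have hcos := Real.cos_le_one_sub_mul_cos_sq hπ
  have hπ0 := Real.pi_pos
  have hπ3 := Real.pi_gt_three
  have hπ10 : Real.pi ^ 2 ≤ 10 := by nlinarith [Real.pi_lt_d2]
  set σ := 4 * r * δ ^ 2 / Real.pi ^ 2 with hσ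
  have hσ0 : 0 ≤ σ := by positivity
  have hσd : σ ≤ d ^ 2 := by
    have : δ ^ 2 ≤ d ^ 2 := by gcongr
    rw [hσ, div_le_iff₀ (by positivity)]
    calc 4 * r * δ ^ 2 ≤ 4 * 1 * d ^ 2 := by gcongr
      _ = d ^ 2 * 2 ^ 2 := by ring
      _ ≤ d ^ 2 * Real.pi ^ 2 := by gcongr; linarith
  have hN : (1 - r) ^ 2 + σ ≤ (1 - r) ^ 2 + 2 * r * (1 - Real.cos θ) := by
    have h2 : 2 / Real.pi ^ 2 * δ ^ 2 ≤ 1 - Real.cos θ := by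
      have : δ ^ 2 ≤ θ ^ 2 := by rw [← sq_abs θ]; gcongr
      have : 2 / Real.pi ^ 2 * δ ^ 2 ≤ 2 / Real.pi ^ 2 * θ ^ 2 := by gcongr
      linarith
    have h3 : σ = 2 * r * (2 / Real.pi ^ 2 * δ ^ 2) := by rw [hσ]; ring
    rw [h3]
    gcongr
  have h4 : r / ((1 - r) ^ 2 + 2 * r * (1 - Real.cos θ)) ≤ r / ((1 - r) ^ 2 + σ) := by gcongr
  have h5 : δ ^ 2 / (20 * d ^ 4) ≤ r / (1 - r) ^ 2 - r / ((1 - r) ^ 2 + σ) := by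
    have e : r / (1 - r) ^ 2 - r / ((1 - r) ^ 2 + σ)
        = r * σ / ((1 - r) ^ 2 * ((1 - r) ^ 2 + σ)) := by
      field_simp; ring
    have hd0 : 0 < d := by linarith
    have h6 : r * σ / (d ^ 2 * (d ^ 2 + d ^ 2)) ≤ r * σ / ((1 - r) ^ 2 * ((1 - r) ^ 2 + σ)) := by
      gcongr
    rw [e]
    refine le_trans ?_ h6
    rw [hσ, div_le_div_iff₀ (by positivity) (by positivity)]
    have h7 : r * (4 * r * δ ^ 2 / Real.pi ^ 2) * (20 * d ^ 4)
        = δ ^ 2 * d ^ 4 * (80 * r ^ 2 / Real.pi ^ 2) := by ring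
    have h8 : 2 ≤ 80 * r ^ 2 / Real.pi ^ 2 := by
      rw [le_div_iff₀ (by positivity)]; nlinarith
    rw [h7]
    calc δ ^ 2 * (d ^ 2 * (d ^ 2 + d ^ 2)) = δ ^ 2 * d ^ 4 * 2 := by ring
      _ ≤ _ := by gcongr
  linarith

/-- The exponent `x^(2/9) / log² x` governing the minor arcs. -/
noncomputable def rate (x : ℝ) : ℝ := x ^ (2 / 9 : ℝ) / Real.log x ^ 2

lemma eventually_mul_rpow_le_rate {κ : ℝ} (hκ : κ < 2 / 9) (K : ℝ) :
    ∀ᶠ x : ℝ in atTop, K * x ^ κ ≤ rate x := by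
  have h := (isLittleO_log_rpow_rpow_atTop 2 (sub_pos.2 hκ)).bound
    (c := 1 / (|K| + 1)) (by positivity)
  filter_upwards [h, eventually_gt_atTop 1] with x hx h1
  have h0 : 0 < x := by linarith
  have hl := Real.log_pos h1
  rw [Real.rpow_two, Real.norm_of_nonneg (by positivity), Real.norm_of_nonneg (by positivity),
    Real.rpow_sub h0] at hx
  rw [rate, le_div_iff₀ (by positivity)]
  have hk : 0 < x ^ κ := by positivity
  calc K * x ^ κ * Real.log x ^ 2 ≤ (|K| + 1) * x ^ κ * Real.log x ^ 2 := by
        gcongr; linarith [le_abs_self K]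
    _ ≤ (|K| + 1) * x ^ κ * (1 / (|K| + 1) * (x ^ (2 / 9 : ℝ) / x ^ κ)) := by gcongr
    _ = x ^ (2 / 9 : ℝ) := by field_simp

lemma eventually_mul_log_le_rate (K : ℝ) : ∀ᶠ x : ℝ in atTop, K * Real.log x ≤ rate x := by
  filter_upwards [eventually_mul_rpow_le_rate (by norm_num : (1 / 9 : ℝ) < 2 / 9) (9 * |K|),
    eventually_gt_atTop 1] with x hx h1
  have hl := Real.log_pos h1
  have h2 := Real.log_le_rpow_div (by linarith : 0 ≤ x) (by norm_num : (0 : ℝ) < 1 / 9)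
  calc K * Real.log x ≤ |K| * Real.log x := by gcongr; exact le_abs_self K
    _ ≤ |K| * (x ^ (1 / 9 : ℝ) / (1 / 9)) := by gcongr
    _ = 9 * |K| * x ^ (1 / 9 : ℝ) := by ring
    _ ≤ _ := hx

lemma tendsto_rate : Tendsto rate atTop atTop :=
  tendsto_atTop_mono' _ (eventually_mul_log_le_rate 1)
    (by simpa using Real.tendsto_log_atTop)

/-- Bounds on the locality function in terms of `d = log (1 / r)` and `a(r)`. -/
lemma locδ_bounds {r : ℝ} (hr : 1 / 2 ≤ r) (h1 : r < 1) (ha : 3 ≤ logSeriesReal 1 r) :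
    0 < locδ r ∧ locδ r ≤ -Real.log r ∧
    locδ r ^ 3 = (-Real.log r) ^ 5 / Real.log (logSeriesReal 1 r) ^ 3 ∧
    rate (logSeriesReal 1 r) / 40 ≤ locδ r ^ 2 / (20 * (-Real.log r) ^ 4) ∧
    1 / (-Real.log r) ≤ 2 * logSeriesReal 1 r := by
  have h0 : 0 < r := by linarith
  rw [locδ, haymanA_Q h0.le h1]
  have hlo := le_logSeriesReal 1 h0 h1
  have hd0 : 0 < -Real.log r := by linarith [Real.log_neg h0 h1]
  have hup := logSeriesReal_le 1 hd0
  rw [neg_neg, Real.exp_log h0] at hup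
  have hd1 : -Real.log r ≤ 1 := by
    have := Real.log_le_log (by norm_num) hr
    rw [one_div, Real.log_inv] at this
    linarith [Real.log_two_lt_d9]
  set d := -Real.log r
  set a := logSeriesReal 1 r
  have hl : 1 ≤ Real.log a := by
    rw [Real.le_log_iff_exp_le (by linarith)]
    linarith [Real.exp_one_lt_d9]
  refine ⟨by positivity, ?_, ?_, ?_, ?_⟩
  · refine (div_le_self (by positivity) hl).trans ?_
    have := Real.rpow_le_rpow_of_exponent_ge hd0 hd1 (by norm_num : (1 : ℝ) ≤ 5 / 3)
    rwa [Real.rpow_one] at this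
  · rw [div_pow, ← Real.rpow_natCast (d ^ (5 / 3 : ℝ)), ← Real.rpow_mul hd0.le]
    norm_num
  · have h3 : a ^ (2 / 9 : ℝ) ≤ 2 * d ^ (-(2 / 3) : ℝ) := by
      have h4 : a ≤ 16 * d ^ (-3 : ℝ) := by
        rw [Real.rpow_neg hd0.le]
        refine hup.trans (le_of_eq ?_)
        norm_num
        field_simp
        norm_num
      have h5 : (16 : ℝ) ^ (2 / 9 : ℝ) ≤ 2 := by
        rw [show (16 : ℝ) = 2 ^ (4 : ℝ) by norm_num, ← Real.rpow_mul (by norm_num)]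
        exact (Real.rpow_le_rpow_of_exponent_le (by norm_num)
          (by norm_num : (4 * (2 / 9) : ℝ) ≤ 1)).trans (by norm_num)
      calc a ^ (2 / 9 : ℝ) ≤ (16 * d ^ (-3 : ℝ)) ^ (2 / 9 : ℝ) := by gcongr
        _ = 16 ^ (2 / 9 : ℝ) * d ^ (-(2 / 3) : ℝ) := by
          rw [Real.mul_rpow (by norm_num) (by positivity), ← Real.rpow_mul hd0.le]; norm_num
        _ ≤ _ := by gcongr
    have h6 : (d ^ (5 / 3 : ℝ)) ^ 2 = d ^ 4 * d ^ (-(2 / 3) : ℝ) := by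
      rw [← Real.rpow_natCast, ← Real.rpow_natCast, ← Real.rpow_mul hd0.le, ← Real.rpow_add hd0]
      norm_num
    rw [rate, div_pow, h6]
    have e : d ^ 4 * d ^ (-(2 / 3) : ℝ) / Real.log a ^ 2 / (20 * d ^ 4)
        = 2 * d ^ (-(2 / 3) : ℝ) / Real.log a ^ 2 / 40 := by field_simp; norm_num
    rw [e]
    gcongr
  · have h3 : 1 / (2 * d) ≤ r / d ^ (1 + 2) := by
      rw [div_le_div_iff₀ (by positivity) (by positivity)]
      have : d ^ (1 + 2) ≤ d := by
        calc d ^ 3 = d * d ^ 2 := by ring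
          _ ≤ d * 1 := by gcongr; nlinarith
          _ = d := mul_one d
      nlinarith
    have h4 : 1 / d = 2 * (1 / (2 * d)) := by field_simp
    rw [h4]
    linarith

/-- The Gaussian approximation of `Q` on the major arc. The locality function is chosen so that
`δ³ d^(-5) = 1 / log³ a` exactly. -/
lemma norm_Q_polar_div_sub_one_le {r θ : ℝ} (hr : 1 / 2 ≤ r) (h1 : r < 1)
    (ha : 3 ≤ logSeriesReal 1 r) (hlog : 1536 / Real.log (logSeriesReal 1 r) ^ 3 ≤ 1)
    (hθ : |θ| ≤ locδ r) :
    ‖Q (polar r θ) / (Q r * Complex.exp (Complex.I * θ * (logSeriesReal 1 r : ℂ)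
      - (θ : ℂ) ^ 2 * (logSeriesReal 2 r : ℂ) / 2)) - 1‖
      ≤ 3072 / Real.log (logSeriesReal 1 r) ^ 3 := by
  obtain ⟨-, -, h3, -, -⟩ := locδ_bounds hr h1 ha
  have h0 : 0 < r := by linarith
  have hd0 : 0 < -Real.log r := by linarith [Real.log_neg h0 h1]
  have hup := logSeriesReal_le 3 hd0
  rw [neg_neg, Real.exp_log h0] at hup
  have hE := norm_logSeries_polar_sub_le h0.le h1 θ
  have hl : 0 < Real.log (logSeriesReal 1 r) := Real.log_pos (by linarith)
  have h4 : 4 * |θ| ^ 3 * logSeriesReal 3 r ≤ 1536 / Real.log (logSeriesReal 1 r) ^ 3 := by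
    have h5 : |θ| ^ 3 ≤ locδ r ^ 3 := by gcongr
    rw [h3] at h5
    have h0' : 0 ≤ logSeriesReal 3 r := (by positivity :
      0 ≤ r / (-Real.log r) ^ (3 + 2)).trans (le_logSeriesReal 3 h0 h1)
    generalize -Real.log r = d at *
    calc 4 * |θ| ^ 3 * logSeriesReal 3 r
        ≤ 4 * (d ^ 5 / Real.log (logSeriesReal 1 r) ^ 3)
          * ((3).factorial * (2 / d) ^ 3 * (8 / d ^ 2)) := by gcongr
      _ = _ := by
        rw [show (Nat.factorial 3 : ℝ) = 6 by norm_num [Nat.factorial]]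
        field_simp
        norm_num
  have h6 := hE.trans h4
  have h7 := Complex.norm_exp_sub_one_le (h6.trans hlog)
  rw [Q_eq_exp (by rwa [norm_polar h0.le]), Q_ofReal h0.le h1, Complex.ofReal_exp,
    ← Complex.exp_add, ← Complex.exp_sub]
  rw [sub_sub] at h7
  refine h7.trans ?_
  rw [← sub_sub]
  calc 2 * _ ≤ 2 * (1536 / Real.log (logSeriesReal 1 r) ^ 3) := by gcongr
    _ = _ := by ring

lemma tendsto_neg_log_nhdsLT_one : Tendsto (fun r => -Real.log r) (𝓝[<] 1) (𝓝[>] 0) := by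
  refine tendsto_nhdsWithin_iff.2 ⟨?_, ?_⟩
  · have : Tendsto (fun r => -Real.log r) (𝓝 1) (𝓝 (-Real.log 1)) :=
      (Real.continuousAt_log one_ne_zero).neg.tendsto
    rw [Real.log_one, neg_zero] at this
    exact this.mono_left nhdsWithin_le_nhds
  · filter_upwards [Ioo_mem_nhdsLT (zero_lt_one' ℝ)] with r hr
    have := Real.log_neg hr.1 hr.2
    simpa using this

lemma eventually_half_le : ∀ᶠ r : ℝ in 𝓝[<] 1, 1 / 2 ≤ r ∧ r < 1 := by
  filter_upwards [Ioo_mem_nhdsLT (by norm_num : (1 / 2 : ℝ) < 1)] with r hr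
  exact ⟨hr.1.le, hr.2⟩

lemma tendsto_logSeriesReal_nhdsLT_one (s : ℕ) :
    Tendsto (logSeriesReal s) (𝓝[<] 1) atTop := by
  have h : Tendsto (fun d : ℝ => 1 / 2 * d⁻¹ ^ (s + 2)) (𝓝[>] 0) atTop :=
    ((tendsto_pow_atTop (by omega)).comp tendsto_inv_nhdsGT_zero).const_mul_atTop (by norm_num)
  refine tendsto_atTop_mono' _ ?_ (h.comp tendsto_neg_log_nhdsLT_one)
  filter_upwards [eventually_half_le] with r hr
  have h0 : 0 < r := by linarith
  have hd0 : 0 < -Real.log r := by linarith [Real.log_neg h0 hr.2]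
  refine le_trans ?_ (le_logSeriesReal s h0 hr.2)
  simp only [Function.comp]
  rw [inv_pow, ← div_eq_mul_inv]
  gcongr
  exact hr.1

lemma sqrt_logSeriesReal_two_le {r : ℝ} (hr : 1 / 2 ≤ r) (h1 : r < 1)
    (ha : 3 ≤ logSeriesReal 1 r) :
    √(logSeriesReal 2 r) ≤ 32 * logSeriesReal 1 r ^ 2 := by
  obtain ⟨-, -, -, -, h5⟩ := locδ_bounds hr h1 ha
  have h0 : 0 < r := by linarith
  have hd0 : 0 < -Real.log r := by linarith [Real.log_neg h0 h1]
  have hup := logSeriesReal_le 2 hd0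
  rw [neg_neg, Real.exp_log h0] at hup
  refine Real.sqrt_le_iff.2 ⟨by positivity, hup.trans ?_⟩
  have h6 : (1 / -Real.log r) ^ 4 ≤ (2 * logSeriesReal 1 r) ^ 4 := by gcongr
  calc _ = 64 * (1 / -Real.log r) ^ 4 := by norm_num; field_simp; norm_num
    _ ≤ 64 * (2 * logSeriesReal 1 r) ^ 4 := by gcongr
    _ = _ := by ring

theorem haymanAdmissible_Q : HaymanAdmissible Q locδ where
  analytic := fun y hy => (differentiableAt_Q (by simpa using hy)).differentiableWithinAt
  positive := by
    have h := (tendsto_logSeriesReal_nhdsLT_one 1).eventually_ge_atTop 3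
    obtain ⟨R, hR, hR2⟩ := (mem_nhdsLT_iff_exists_Ioo_subset' (zero_lt_one' ℝ)).1
      (h.and eventually_half_le)
    refine ⟨max R (1 / 2), by positivity, max_lt hR (by norm_num), fun r hr h1 => ?_⟩
    obtain ⟨ha, hh, -⟩ := hR2 ⟨(le_max_left _ _).trans_lt hr, h1⟩
    have h0 : 0 < r := by linarith
    obtain ⟨h3, h4, -⟩ := locδ_bounds hh h1 ha
    rw [Q_ofReal h0.le h1]
    refine ⟨Complex.ofReal_im _, by rw [Complex.ofReal_re]; positivity, h3, h4.trans_lt ?_⟩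
    have := Real.log_le_log (by norm_num) hh
    rw [one_div, Real.log_inv] at this
    linarith [Real.log_two_lt_d9, Real.pi_gt_three]
  capture_a := (tendsto_logSeriesReal_nhdsLT_one 1).congr' <| by
    filter_upwards [eventually_half_le] with r hr
    exact (haymanA_Q (by linarith) hr.2).symm
  capture_b := (tendsto_logSeriesReal_nhdsLT_one 2).congr' <| by
    filter_upwards [eventually_half_le] with r hr
    exact (haymanB_Q (by linarith) hr.2).symm
  locality := fun ε hε => by
    have hlim : Tendsto (fun r => 3072 / Real.log (logSeriesReal 1 r) ^ 3) (𝓝[<] 1) (𝓝 0) :=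
      ((tendsto_pow_atTop (by norm_num)).comp (Real.tendsto_log_atTop.comp
        (tendsto_logSeriesReal_nhdsLT_one 1))).const_div_atTop _
    filter_upwards [(tendsto_logSeriesReal_nhdsLT_one 1).eventually_ge_atTop 3,
      eventually_half_le, hlim.eventually (ge_mem_nhds hε),
      hlim.eventually (ge_mem_nhds one_pos)] with r ha hr he h1 θ hθ
    rw [haymanA_Q (by linarith) hr.2, haymanB_Q (by linarith) hr.2]
    refine (norm_Q_polar_div_sub_one_le hr.1 hr.2 ha (le_trans ?_ h1) hθ).trans he
    have := Real.log_pos (by linarith : 1 < logSeriesReal 1 r)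
    gcongr
    norm_num
  decay := fun ε hε => by
    have ht := tendsto_logSeriesReal_nhdsLT_one 1
    -- a factor `e^(-rate a / 80)` absorbs `√b ≤ 32 a²`, the remaining one tends to `0`
    have hlim : Tendsto (fun r => Real.exp (-(rate (logSeriesReal 1 r) / 80))) (𝓝[<] 1) (𝓝 0) :=
      Real.tendsto_exp_neg_atTop_nhds_zero.comp
        ((tendsto_rate.comp ht).atTop_div_const (by norm_num))
    filter_upwards [ht.eventually_ge_atTop 32,
      eventually_half_le, hlim.eventually (ge_mem_nhds hε),
      ht.eventually (eventually_mul_log_le_rate 240)] with r ha hr he hlog θ hθ hπ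
    have ha3 : 3 ≤ logSeriesReal 1 r := by linarith
    have h0 : 0 < r := by linarith
    obtain ⟨h3, h4, -, h5, -⟩ := locδ_bounds hr.1 hr.2 ha3
    rw [haymanB_Q h0.le hr.2]
    have hQ := norm_Q_polar_le hr.1 hr.2 h3.le h4 hθ.le hπ
    have hb0 : 0 < logSeriesReal 2 r :=
      (by have := Real.log_neg h0 hr.2
          have : 0 < -Real.log r := by linarith
          positivity : 0 < r / (-Real.log r) ^ (2 + 2)).trans_le (le_logSeriesReal 2 h0 hr.2)
    have hb := sqrt_logSeriesReal_two_le hr.1 hr.2 ha3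
    have hs : 0 < √(logSeriesReal 2 r) := Real.sqrt_pos.2 hb0
    set a := logSeriesReal 1 r
    have h6 : √(logSeriesReal 2 r) ≤ Real.exp (rate a / 80) := by
      refine hb.trans ?_
      calc 32 * a ^ 2 ≤ a * a ^ 2 := by gcongr
        _ = Real.exp (3 * Real.log a) := by
          rw [show 3 * Real.log a = ((3 : ℕ) : ℝ) * Real.log a by norm_num, Real.exp_nat_mul,
            Real.exp_log (by linarith)]; ring
        _ ≤ _ := Real.exp_le_exp.2 (by linarith)
    refine hQ.trans ?_
    rw [mul_div_assoc', le_div_iff₀ hs, mul_comm ε, mul_assoc]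
    gcongr
    calc Real.exp (-(locδ r ^ 2 / (20 * (-Real.log r) ^ 4))) * √(logSeriesReal 2 r)
        ≤ Real.exp (-(rate a / 40)) * Real.exp (rate a / 80) := by
          gcongr
      _ = Real.exp (-(rate a / 80)) := by rw [← Real.exp_add]; ring_nf
      _ ≤ ε := he

/-! ### Cauchy's formula at the saddle point -/

lemma polar_eq_circleMap (r θ : ℝ) : polar r θ = circleMap 0 r θ := by
  rw [polar, circleMap, zero_add, mul_comm Complex.I]

lemma continuous_polar (r : ℝ) : Continuous (polar r) := by
  unfold polar; fun_prop

lemma polar_periodic (r : ℝ) : Function.Periodic (polar r) (2 * Real.pi) := fun θ => by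
  rw [polar_eq_circleMap, polar_eq_circleMap, periodic_circleMap]

/-- Cauchy's formula for Taylor coefficients, over the symmetric interval `[-π, π]`. -/
lemma taylorCoeff_eq_integral {G : ℂ → ℂ} (hG : DifferentiableOn ℂ G (Metric.ball 0 1)) {r : ℝ}
    (h0 : 0 < r) (h1 : r < 1) (n : ℕ) :
    ∫ θ in -Real.pi..Real.pi, G (polar r θ) * Complex.exp (-(Complex.I * θ * n))
      = 2 * Real.pi * r ^ n * taylorCoeff G n := by
  have hc := DifferentiableOn.circleIntegral_one_div_sub_center_pow_smul h0 n
    (hG.mono (Metric.closedBall_subset_ball h1))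
  have hr : (r : ℂ) ≠ 0 := by exact_mod_cast h0.ne'
  have hint : ∀ θ : ℝ, deriv (circleMap 0 r) θ •
      ((1 / (circleMap 0 r θ - 0) ^ (n + 1)) • G (circleMap 0 r θ))
      = Complex.I / r ^ n * (G (polar r θ) * Complex.exp (-(Complex.I * θ * n))) := fun θ => by
    have hp : polar r θ ≠ 0 := by
      rw [← norm_ne_zero_iff, norm_polar h0.le]; exact h0.ne'
    have he : Complex.exp (-(Complex.I * θ * n)) = r ^ n / polar r θ ^ n := by
      rw [polar, mul_pow, ← Complex.exp_nat_mul, mul_comm (n : ℂ), Complex.exp_neg]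
      field_simp
    rw [deriv_circleMap, ← polar_eq_circleMap, he, sub_zero, smul_eq_mul, smul_eq_mul]
    field_simp
    ring
  rw [circleIntegral] at hc
  simp_rw [hint] at hc
  rw [intervalIntegral.integral_const_mul] at hc
  have hper : Function.Periodic
      (fun θ : ℝ => G (polar r θ) * Complex.exp (-(Complex.I * θ * n))) (2 * Real.pi) := fun θ => by
    have h2 : Complex.exp (-(Complex.I * ((θ + 2 * Real.pi : ℝ) : ℂ) * n))
        = Complex.exp (-(Complex.I * θ * n)) := by
      rw [Complex.exp_eq_exp_iff_exists_int]
      exact ⟨-n, by push_cast; ring⟩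
    simp only [polar_periodic r θ, h2]
  have h3 := hper.intervalIntegral_add_eq (-Real.pi) 0
  rw [show -Real.pi + 2 * Real.pi = Real.pi by ring, zero_add] at h3
  rw [h3, taylorCoeff]
  have hf : (n.factorial : ℂ) ≠ 0 := by exact_mod_cast n.factorial_ne_zero
  simp only [smul_eq_mul] at hc
  generalize ∫ θ in (0 : ℝ)..2 * Real.pi,
    G (polar r θ) * Complex.exp (-(Complex.I * θ * n)) = J at hc ⊢
  field_simp at hc ⊢
  linear_combination hc

lemma le_integral_gaussian {b δ : ℝ} (hb : 0 < b) (hδ : 1 ≤ δ * √b) :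
    1 / (2 * √b) ≤ ∫ θ in -δ..δ, Real.exp (-(θ ^ 2 * b / 2)) := by
  have hs : 0 < √b := Real.sqrt_pos.2 hb
  have hw : 1 / √b ≤ δ := by rwa [div_le_iff₀ hs]
  have hw0 : 0 < 1 / √b := by positivity
  have hcont : Continuous fun θ : ℝ => Real.exp (-(θ ^ 2 * b / 2)) := by fun_prop
  have h1 : ∫ θ in (0 : ℝ)..1 / √b, Real.exp (-(θ ^ 2 * b / 2))
      ≤ ∫ θ in -δ..δ, Real.exp (-(θ ^ 2 * b / 2)) :=
    intervalIntegral.integral_mono_interval (by linarith) hw0.le hw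
      (Eventually.of_forall fun θ => (Real.exp_pos _).le) (hcont.intervalIntegrable _ _)
  refine le_trans ?_ h1
  have h2 : ∫ θ in (0 : ℝ)..1 / √b, (1 / 2 : ℝ)
      ≤ ∫ θ in (0 : ℝ)..1 / √b, Real.exp (-(θ ^ 2 * b / 2)) := by
    refine intervalIntegral.integral_mono_on hw0.le (by simp) (hcont.intervalIntegrable _ _)
      fun θ hθ => ?_
    have h3 : θ ^ 2 * b ≤ 1 := by
      calc θ ^ 2 * b ≤ (1 / √b) ^ 2 * b := by
            have := hθ.1
            have := hθ.2
            gcongr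
        _ = 1 := by rw [div_pow, Real.sq_sqrt hb.le]; field_simp
    have := Real.add_one_le_exp (-(θ ^ 2 * b / 2))
    linarith
  refine le_trans (le_of_eq ?_) h2
  simp

/-- The weighted mean of `f` against a complex weight `P` that is close to a positive weight `g` on
`[-δ, δ]` and small elsewhere is close to the value `z` which `f` nearly takes on `[-δ, δ]`. -/
lemma norm_integral_div_integral_sub_le {P f : ℝ → ℂ} {g : ℝ → ℝ} {δ ε μ B : ℝ} {z : ℂ}
    (hP : Continuous P) (hf : Continuous f) (hg : Continuous g) (hδ0 : 0 ≤ δ) (hδ : δ ≤ Real.pi)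
    (hμ : 0 ≤ μ) (hε : 0 ≤ ε)
    (hPg : ∀ θ, |θ| ≤ δ → ‖P θ - g θ‖ ≤ 1 / 2 * g θ)
    (hfz : ∀ θ, |θ| ≤ δ → ‖f θ - z‖ ≤ ε * ‖z‖)
    (hPμ : ∀ θ, δ ≤ |θ| → |θ| ≤ Real.pi → ‖P θ‖ ≤ μ)
    (hfB : ∀ θ, ‖f θ‖ ≤ B) (hzB : ‖z‖ ≤ B) (hM : 8 * Real.pi * μ ≤ ∫ θ in -δ..δ, g θ)
    (hM0 : 0 < ∫ θ in -δ..δ, g θ) :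
    ‖(∫ θ in -Real.pi..Real.pi, P θ * f θ) / (∫ θ in -Real.pi..Real.pi, P θ) - z‖
      ≤ 6 * ε * ‖z‖ + 16 * Real.pi * B * μ / ∫ θ in -δ..δ, g θ := by
  set M := ∫ θ in -δ..δ, g θ
  have hπ := Real.pi_pos
  have hB : 0 ≤ B := (norm_nonneg z).trans hzB
  have split (k : ℝ → ℂ) (hk : Continuous k) : ∫ θ in -Real.pi..Real.pi, k θ
      = (∫ θ in -Real.pi..-δ, k θ) + (∫ θ in -δ..δ, k θ) + ∫ θ in δ..Real.pi, k θ := by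
    rw [intervalIntegral.integral_add_adjacent_intervals (hk.intervalIntegrable _ _)
      (hk.intervalIntegrable _ _), intervalIntegral.integral_add_adjacent_intervals
      (hk.intervalIntegrable _ _) (hk.intervalIntegrable _ _)]
  have outer (k : ℝ → ℂ) (K : ℝ) (hK : 0 ≤ K)
      (hk : ∀ θ, δ ≤ |θ| → |θ| ≤ Real.pi → ‖k θ‖ ≤ K) :
      ‖∫ θ in -Real.pi..-δ, k θ‖ ≤ K * Real.pi ∧ ‖∫ θ in δ..Real.pi, k θ‖ ≤ K * Real.pi := by
    constructor
    · refine (intervalIntegral.norm_integral_le_of_norm_le_const fun θ hθ => ?_).trans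
        (mul_le_mul_of_nonneg_left ?_ hK)
      · rw [Set.uIoc_of_le (by linarith)] at hθ
        have h1 : |θ| = -θ := abs_of_nonpos (by linarith [hθ.2])
        exact hk θ (by rw [h1]; linarith [hθ.2]) (by rw [h1]; linarith [hθ.1])
      · rw [abs_of_nonneg (by linarith)]; linarith
    · refine (intervalIntegral.norm_integral_le_of_norm_le_const fun θ hθ => ?_).trans
        (mul_le_mul_of_nonneg_left ?_ hK)
      · rw [Set.uIoc_of_le (by linarith)] at hθ
        have h1 : |θ| = θ := abs_of_nonneg (by linarith [hθ.1])
        exact hk θ (by rw [h1]; linarith [hθ.1]) (by rw [h1]; linarith [hθ.2])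
      · rw [abs_of_nonneg (by linarith)]; linarith
  have inner (k : ℝ → ℂ) (c : ℝ) (hk : ∀ θ, |θ| ≤ δ → ‖k θ‖ ≤ c * g θ) :
      ‖∫ θ in -δ..δ, k θ‖ ≤ c * M := by
    rw [← intervalIntegral.integral_const_mul]
    refine intervalIntegral.norm_integral_le_of_norm_le (by linarith)
      (Eventually.of_forall fun θ hθ => hk θ (abs_le.2 ⟨hθ.1.le, hθ.2⟩))
      ((hg.const_mul c).intervalIntegrable _ _)
  have hPn : ∀ θ, |θ| ≤ δ → ‖P θ‖ ≤ 3 / 2 * g θ := fun θ hθ => by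
    have h1 := hPg θ hθ
    have hg0 : 0 ≤ g θ := by linarith [(norm_nonneg _).trans h1]
    have h2 : ‖P θ‖ ≤ ‖P θ - g θ‖ + ‖(g θ : ℂ)‖ := by
      simpa using norm_add_le (P θ - g θ) (g θ : ℂ)
    rw [Complex.norm_real, Real.norm_of_nonneg hg0] at h2
    linarith
  set D := ∫ θ in -Real.pi..Real.pi, P θ with hD
  have hDlow : M / 4 ≤ ‖D‖ := by
    obtain ⟨h1, h2⟩ := outer P μ hμ hPμ
    have h3 := inner (fun θ => P θ - g θ) (1 / 2) hPg
    have hgc : Continuous fun θ => (g θ : ℂ) := by fun_prop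
    rw [intervalIntegral.integral_sub (hP.intervalIntegrable _ _) (hgc.intervalIntegrable _ _),
      intervalIntegral.integral_ofReal] at h3
    have h4 : (M : ℂ) = D - (∫ θ in -Real.pi..-δ, P θ) - (∫ θ in δ..Real.pi, P θ)
        - ((∫ θ in -δ..δ, P θ) - M) := by rw [hD, split P hP]; ring
    have h5 : M = ‖(M : ℂ)‖ := by rw [Complex.norm_real, Real.norm_of_nonneg hM0.le]
    have h6 := norm_sub_le (D - (∫ θ in -Real.pi..-δ, P θ) - (∫ θ in δ..Real.pi, P θ))
      ((∫ θ in -δ..δ, P θ) - M)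
    have h7 := norm_sub_le (D - ∫ θ in -Real.pi..-δ, P θ) (∫ θ in δ..Real.pi, P θ)
    have h8 := norm_sub_le D (∫ θ in -Real.pi..-δ, P θ)
    rw [← h4, ← h5] at h6
    linarith
  have hD0 : D ≠ 0 := norm_pos_iff.1 (by linarith)
  have hnum : ‖(∫ θ in -Real.pi..Real.pi, P θ * f θ) - z * D‖
      ≤ 3 / 2 * ε * ‖z‖ * M + 4 * Real.pi * B * μ := by
    have hPf : Continuous fun θ => P θ * f θ := hP.mul hf
    have hzP : Continuous fun θ => z * P θ := hP.const_mul z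
    rw [hD, ← intervalIntegral.integral_const_mul, ← intervalIntegral.integral_sub
      (hPf.intervalIntegrable _ _) (hzP.intervalIntegrable _ _), split _ (by fun_prop)]
    have hfac : ∀ θ, P θ * f θ - z * P θ = P θ * (f θ - z) := fun θ => by ring
    obtain ⟨h1, h2⟩ := outer (fun θ => P θ * f θ - z * P θ) (μ * (2 * B)) (by positivity)
      fun θ h3 h4 => by
        rw [hfac, norm_mul]
        have := norm_sub_le (f θ) z
        have := hfB θ
        have := hPμ θ h3 h4
        gcongr
        linarith
    have h3 := inner (fun θ => P θ * f θ - z * P θ) (3 / 2 * ε * ‖z‖) fun θ h3 => by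
      rw [hfac, norm_mul]
      have h4 := hPn θ h3
      have h5 := hfz θ h3
      calc ‖P θ‖ * ‖f θ - z‖ ≤ (3 / 2 * g θ) * (ε * ‖z‖) := by
            have := (norm_nonneg _).trans h4
            gcongr
        _ = _ := by ring
    have h6 := norm_add₃_le (a := ∫ θ in -Real.pi..-δ, (P θ * f θ - z * P θ))
      (b := ∫ θ in -δ..δ, (P θ * f θ - z * P θ)) (c := ∫ θ in δ..Real.pi, (P θ * f θ - z * P θ))
    linarith
  rw [div_sub' hD0, norm_div, mul_comm D z]
  calc _ ≤ (3 / 2 * ε * ‖z‖ * M + 4 * Real.pi * B * μ) / (M / 4) := by gcongr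
    _ = _ := by field_simp; ring

/-- Hayman's method at the saddle point `r` with `a(r) = n`, in quantitative form. The numerical
hypotheses on `n` hold from some point on: the saving `e^(-rate n / 40)` on the minor arcs has to
absorb `F` and the polynomial factor `√b(r) ≤ 32 n²`. -/
lemma norm_coeff_ratio_sub_le {F : ℂ → ℂ} (hF : DifferentiableOn ℂ F (Metric.ball 0 1))
    {r ε B : ℝ} {n : ℕ} (hr : 1 / 2 ≤ r) (h1 : r < 1) (hn : logSeriesReal 1 r = n)
    (hn0 : (4000 : ℝ) ≤ n) (hlog : 3072 / Real.log n ^ 3 ≤ 1 / 2)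
    (hrate : 360 * Real.log n ≤ rate n) (hrate4 : 4 ≤ rate n) (hε : 0 ≤ ε) (hε1 : ε < 1)
    (hA : ∀ θ, |θ| ≤ locδ r → ‖F (polar r θ) / F r - 1‖ ≤ ε)
    (hB : ∀ θ, ‖F (polar r θ)‖ ≤ B) (hBr : B ≤ Real.exp (rate n / 240)) :
    ‖taylorCoeff (fun x => Q x * F x) n / q n - F r‖
      ≤ 6 * ε * ‖F r‖ + Real.exp (-(rate n / 80)) := by
  have h0 : 0 < r := by linarith
  have ha : 3 ≤ logSeriesReal 1 r := by rw [hn]; linarith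
  obtain ⟨hδ0, hδd, -, hδr, -⟩ := locδ_bounds hr h1 ha
  have hd0 : 0 < -Real.log r := by linarith [Real.log_neg h0 h1]
  have hd1 : -Real.log r ≤ 1 := by
    have := Real.log_le_log (by norm_num) hr
    rw [one_div, Real.log_inv] at this
    linarith [Real.log_two_lt_d9]
  have hb := sqrt_logSeriesReal_two_le hr h1 ha
  have hblo := le_logSeriesReal 2 h0 h1
  have hb0 : 0 < logSeriesReal 2 r :=
    (by positivity : 0 < r / (-Real.log r) ^ (2 + 2)).trans_le hblo
  have hs0 := Real.sqrt_pos.2 hb0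
  -- otherwise the quotient in `hA` is the junk value `0`, at distance `1 > ε` from `1`
  have hF0 : F r ≠ 0 := fun h => by
    have := hA 0 (by simpa using hδ0.le)
    rw [h] at this
    norm_num at this
    linarith
  have hp0 : polar r 0 = r := by simp [polar]
  have hlog0 : 0 < Real.log n := Real.log_pos (by linarith)
  set X := rate n with hX
  -- the major arc contains the bulk of the Gaussian
  have hδb : 1 ≤ locδ r * √(logSeriesReal 2 r) := by
    have h2 : 1 ≤ locδ r ^ 2 * logSeriesReal 2 r := by
      rw [hn] at hδr
      calc (1 : ℝ) ≤ 10 * (X / 40) := by linarith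
        _ ≤ 10 * (locδ r ^ 2 / (20 * (-Real.log r) ^ 4)) := by gcongr
        _ = locδ r ^ 2 * (1 / 2 / (-Real.log r) ^ (2 + 2)) := by
          generalize -Real.log r = d at *; field_simp; norm_num
        _ ≤ locδ r ^ 2 * (r / (-Real.log r) ^ (2 + 2)) := by gcongr
        _ ≤ _ := by gcongr
    have h3 := Real.sqrt_le_sqrt h2
    rwa [Real.sqrt_one, Real.sqrt_mul (sq_nonneg _), Real.sqrt_sq hδ0.le] at h3
  have hM := le_integral_gaussian hb0 hδb
  set M := ∫ θ in -(locδ r)..locδ r, Real.exp (-(θ ^ 2 * logSeriesReal 2 r / 2)) with hMdef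
  have hM0 : 0 < M := (by positivity : 0 < 1 / (2 * √(logSeriesReal 2 r))).trans_le hM
  have hMinv : 1 / M ≤ 64 * (n : ℝ) ^ 2 := by
    rw [hn] at hb
    rw [div_le_iff₀ hM0]
    calc (1 : ℝ) = 2 * √(logSeriesReal 2 r) * (1 / (2 * √(logSeriesReal 2 r))) := by field_simp
      _ ≤ 2 * (32 * (n : ℝ) ^ 2) * M := by gcongr
      _ = _ := by ring
  have hpoly : 16 * Real.pi * (64 * (n : ℝ) ^ 2) ≤ Real.exp (X / 120) := by
    calc 16 * Real.pi * (64 * (n : ℝ) ^ 2) ≤ n * (n : ℝ) ^ 2 := by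
          have := Real.pi_lt_d2
          nlinarith [sq_nonneg (n : ℝ)]
      _ = Real.exp (((3 : ℕ) : ℝ) * Real.log n) := by
          rw [Real.exp_nat_mul, Real.exp_log (by linarith)]; ring
      _ ≤ _ := Real.exp_le_exp.2 (by push_cast; linarith)
  set μ := Real.exp (-(X / 40)) with hμ
  have hμM : 8 * Real.pi * μ ≤ M := by
    have h2 : 16 * Real.pi * (1 / M) * μ ≤ 1 := by
      calc 16 * Real.pi * (1 / M) * μ ≤ 16 * Real.pi * (64 * (n : ℝ) ^ 2) * μ := by gcongr
        _ ≤ Real.exp (X / 120) * μ := by gcongr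
        _ = Real.exp (-(X / 60)) := by rw [hμ, ← Real.exp_add]; ring_nf
        _ ≤ 1 := Real.exp_le_one_iff.2 (by linarith)
    have h3 : 16 * Real.pi * (1 / M) * μ = 16 * Real.pi * μ / M := by ring
    rw [h3, div_le_one hM0] at h2
    have : 0 < Real.pi * μ := by positivity
    linarith
  have hmem : ∀ θ, polar r θ ∈ Metric.ball (0 : ℂ) 1 := fun θ => by
    rw [mem_ball_zero_iff, norm_polar h0.le]; exact h1
  have hQd : DifferentiableOn ℂ Q (Metric.ball 0 1) := haymanAdmissible_Q.analytic
  have hQc : Continuous fun θ => Q (polar r θ) :=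
    hQd.continuousOn.comp_continuous (continuous_polar r) hmem
  have hFc : Continuous fun θ => F (polar r θ) :=
    hF.continuousOn.comp_continuous (continuous_polar r) hmem
  have hQn := norm_Q_ofReal h0.le h1
  have hQ0 : Q r ≠ 0 := norm_pos_iff.1 (by rw [hQn]; positivity)
  have hBnn : 0 ≤ B := (norm_nonneg _).trans (hB 0)
  have main := norm_integral_div_integral_sub_le (δ := locδ r) (ε := ε) (μ := μ) (B := B) (z := F r)
    (P := fun θ => Q (polar r θ) / Q r * Complex.exp (-(Complex.I * θ * n)))
    (f := fun θ => F (polar r θ))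
    (g := fun θ => Real.exp (-(θ ^ 2 * logSeriesReal 2 r / 2)))
    (by fun_prop) hFc (by fun_prop) hδ0.le (by linarith [Real.pi_gt_three]) (Real.exp_pos _).le hε
    (fun θ hθ => by
      have h2 := norm_Q_polar_div_sub_one_le hr h1 ha (by
        rw [hn]; refine le_trans ?_ (hlog.trans (by norm_num)); gcongr; norm_num) hθ
      rw [hn] at h2
      have h3 := h2.trans hlog
      set E := Complex.exp (Complex.I * θ * ((n : ℝ) : ℂ)
        - (θ : ℂ) ^ 2 * (logSeriesReal 2 r : ℂ) / 2) with hE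
      have hE0 : E ≠ 0 := Complex.exp_ne_zero _
      have hg : ((Real.exp (-(θ ^ 2 * logSeriesReal 2 r / 2)) : ℝ) : ℂ)
          = E * Complex.exp (-(Complex.I * θ * n)) := by
        rw [hE, ← Complex.exp_add]
        push_cast
        ring_nf
      have h4 : Q (polar r θ) / Q r * Complex.exp (-(Complex.I * θ * n))
          - ((Real.exp (-(θ ^ 2 * logSeriesReal 2 r / 2)) : ℝ) : ℂ)
          = (Q (polar r θ) / (Q r * E) - 1)
            * ((Real.exp (-(θ ^ 2 * logSeriesReal 2 r / 2)) : ℝ) : ℂ) := by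
        rw [hg]; field_simp
      rw [h4, norm_mul, Complex.norm_real, Real.norm_of_nonneg (Real.exp_pos _).le]
      gcongr)
    (fun θ hθ => by
      have h2 := hA θ hθ
      rw [div_sub_one hF0, norm_div, div_le_iff₀ (norm_pos_iff.2 hF0)] at h2
      exact h2)
    (fun θ h2 h3 => by
      have h4 := norm_Q_polar_le hr h1 hδ0.le hδd h2 h3
      have h5 : ‖Complex.exp (-(Complex.I * θ * n))‖ = 1 := by
        rw [Complex.norm_exp]; simp
      rw [norm_mul, norm_div, h5, mul_one, div_le_iff₀ (norm_pos_iff.2 hQ0), mul_comm]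
      refine h4.trans ?_
      rw [hμ]
      rw [hn] at hδr
      gcongr)
    hB (by simpa [hp0] using hB 0) hμM hM0
  have hT : taylorCoeff (fun x => Q x * F x) n / q n
      = (∫ θ in -Real.pi..Real.pi, Q (polar r θ) / Q r * Complex.exp (-(Complex.I * θ * n))
          * F (polar r θ))
        / ∫ θ in -Real.pi..Real.pi, Q (polar r θ) / Q r * Complex.exp (-(Complex.I * θ * n)) := by
    have e1 := taylorCoeff_eq_integral (hQd.mul hF) h0 h1 n
    have e2 := taylorCoeff_eq_integral hQd h0 h1 n
    have e3 : ∀ θ : ℝ, Q (polar r θ) / Q r * Complex.exp (-(Complex.I * θ * n)) * F (polar r θ)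
        = (Q r)⁻¹ * (Q (polar r θ) * F (polar r θ) * Complex.exp (-(Complex.I * θ * n))) :=
      fun θ => by ring
    have e4 : ∀ θ : ℝ, Q (polar r θ) / Q r * Complex.exp (-(Complex.I * θ * n))
        = (Q r)⁻¹ * (Q (polar r θ) * Complex.exp (-(Complex.I * θ * n))) := fun θ => by ring
    simp_rw [e3, e4, intervalIntegral.integral_const_mul]
    have hK : (2 * Real.pi * r ^ n : ℂ) ≠ 0 := by
      have := Real.pi_ne_zero
      have := h0.ne'
      exact_mod_cast (by positivity : 2 * Real.pi * r ^ n ≠ 0)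
    have e1' : ∫ θ in -Real.pi..Real.pi, Q (polar r θ) * F (polar r θ)
        * Complex.exp (-(Complex.I * θ * n))
        = 2 * Real.pi * r ^ n * taylorCoeff (fun x => Q x * F x) n := e1
    rw [e1', e2, mul_div_mul_left _ _ (inv_ne_zero hQ0), mul_div_mul_left _ _ hK, q]
  rw [hT]
  refine main.trans (add_le_add le_rfl ?_)
  calc 16 * Real.pi * B * μ / M = 16 * Real.pi * (1 / M) * (B * μ) := by ring
    _ ≤ 16 * Real.pi * (64 * (n : ℝ) ^ 2) * (Real.exp (X / 240) * μ) := by gcongr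
    _ ≤ Real.exp (X / 120) * (Real.exp (X / 240) * μ) := by gcongr
    _ = Real.exp (-(X / 80)) := by rw [hμ, ← Real.exp_add, ← Real.exp_add]; ring_nf

/-! ### Moving off the circle with the three lines theorem -/

/-- If `f` is analytic in the unit disc, bounded by `A` on the arc `{r e^(iθ) : |θ| ≤ δ}` and by `B`
on an annulus around it, then its size at `r e^y` is controlled by the three lines theorem: the map
`u ↦ r exp (± δ sinh u)` sends the line `Re u = 0` onto the arc, and a real point `u ≤ |y| / δ` to
`r e^y`. -/
lemma norm_le_of_arc {f : ℂ → ℂ} (hf : DifferentiableOn ℂ f (Metric.ball 0 1)) {d δ A B y : ℝ}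
    (hδ : 0 < δ) (hδd : 4 * δ ≤ d) (hy : |y| ≤ δ)
    (hA : ∀ θ, |θ| ≤ δ → ‖f (polar (Real.exp (-d)) θ)‖ ≤ A)
    (hB : ∀ z : ℂ, Real.exp (-(2 * d)) ≤ ‖z‖ → ‖z‖ ≤ Real.exp (-(d / 2)) → ‖f z‖ ≤ B) :
    ∃ u : ℝ, 0 ≤ u ∧ u ≤ |y| / δ ∧
      ‖f ((Real.exp (-d + y) : ℝ) : ℂ)‖ ≤ A ^ (1 - u) * B ^ u := by
  have hd : 0 < d := by linarith
  obtain ⟨σ, hσ, hσy⟩ : ∃ σ : ℝ, |σ| = 1 ∧ σ * |y| = y := by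
    rcases le_total 0 y with h | h
    · exact ⟨1, by simp, by rw [abs_of_nonneg h, one_mul]⟩
    · exact ⟨-1, by simp, by rw [abs_of_nonpos h]; ring⟩
  have hsinh1 : Real.sinh 1 ≤ 2 := by
    rw [Real.sinh_eq]
    linarith [Real.exp_one_lt_d9, Real.exp_pos (-1)]
  set φ : ℂ → ℂ := fun u => Complex.exp (-d + σ * δ * Complex.sinh u) with hφ
  have hφd : Differentiable ℂ φ := by
    refine Differentiable.cexp ?_
    exact (differentiable_const _).add (Complex.differentiable_sinh.const_mul _)
  have hre (u : ℂ) : (-(d : ℂ) + σ * δ * Complex.sinh u).re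
      = -d + σ * δ * (Real.sinh u.re * Real.cos u.im) := by
    have h1 : (Complex.sinh u).re = Real.sinh u.re * Real.cos u.im := by
      conv_lhs => rw [← Complex.re_add_im u]
      rw [Complex.sinh_add, Complex.sinh_mul_I, Complex.cosh_mul_I, ← Complex.ofReal_sinh,
        ← Complex.ofReal_cosh, ← Complex.ofReal_cos, ← Complex.ofReal_sin]
      simp [-Complex.ofReal_sinh, -Complex.ofReal_cosh, -Complex.ofReal_cos, -Complex.ofReal_sin]
    rw [Complex.add_re, ← Complex.ofReal_mul, Complex.re_ofReal_mul, h1]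
    simp
  have hstrip : ∀ u ∈ Complex.HadamardThreeLines.verticalClosedStrip 0 1,
      Real.exp (-(2 * d)) ≤ ‖φ u‖ ∧ ‖φ u‖ ≤ Real.exp (-(d / 2)) := fun u hu => by
    have hu' : 0 ≤ u.re ∧ u.re ≤ 1 := hu
    have h2 : |σ * δ * (Real.sinh u.re * Real.cos u.im)| ≤ 2 * δ := by
      rw [abs_mul, abs_mul, abs_mul, hσ, one_mul, abs_of_pos hδ,
        abs_of_nonneg (Real.sinh_nonneg_iff.2 hu'.1), mul_comm 2 δ]
      have h3 : Real.sinh u.re ≤ 2 := (Real.sinh_le_sinh.2 hu'.2).trans hsinh1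
      have h4 := Real.abs_cos_le_one u.im
      have h5 := Real.sinh_nonneg_iff.2 hu'.1
      gcongr
      nlinarith [abs_nonneg (Real.cos u.im)]
    rw [hφ]
    simp only [Complex.norm_exp, hre]
    obtain ⟨h3, h4⟩ := abs_le.1 h2
    exact ⟨Real.exp_le_exp.2 (by linarith), Real.exp_le_exp.2 (by linarith)⟩
  have hball : Set.MapsTo φ (Complex.HadamardThreeLines.verticalClosedStrip 0 1)
      (Metric.ball 0 1) := fun u hu => by
    rw [mem_ball_zero_iff]
    exact (hstrip u hu).2.trans_lt (Real.exp_lt_one_iff.2 (by linarith))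
  have hcl : closure (Complex.HadamardThreeLines.verticalStrip 0 1)
      = Complex.HadamardThreeLines.verticalClosedStrip 0 1 := by
    rw [Complex.HadamardThreeLines.verticalClosedStrip, ← closure_Ioo zero_ne_one,
      Complex.HadamardThreeLines.verticalStrip, Complex.closure_preimage_re]
  have hdc : DiffContOnCl ℂ (f ∘ φ) (Complex.HadamardThreeLines.verticalStrip 0 1) := by
    refine DifferentiableOn.diffContOnCl ?_
    rw [hcl]
    exact hf.comp hφd.differentiableOn hball
  have hbound : ∀ u ∈ Complex.HadamardThreeLines.verticalClosedStrip 0 1, ‖(f ∘ φ) u‖ ≤ B :=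
    fun u hu => hB _ (hstrip u hu).1 (hstrip u hu).2
  set u := Real.arsinh (|y| / δ) with hu
  have hyδ : 0 ≤ |y| / δ := by positivity
  have hu0 : 0 ≤ u := Real.arsinh_nonneg_iff.2 hyδ
  have hsu : Real.sinh u = |y| / δ := Real.sinh_arsinh _
  have hule : u ≤ |y| / δ := by rw [← hsu]; exact Real.self_le_sinh_iff.2 hu0
  have hu1 : u ≤ 1 := hule.trans (by rwa [div_le_one hδ])
  refine ⟨u, hu0, hule, ?_⟩
  have key := Complex.HadamardThreeLines.norm_le_interp_of_mem_verticalClosedStrip₀₁' (f ∘ φ)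
    (z := (u : ℂ)) (a := A) (b := B) (show (0 : ℝ) ≤ _ ∧ _ ≤ (1 : ℝ) from ⟨hu0, hu1⟩) hdc
    ⟨B, by rintro _ ⟨v, hv, rfl⟩; exact hbound v hv⟩ ?_ ?_
  · have hφu : φ u = ((Real.exp (-d + y) : ℝ) : ℂ) := by
      rw [hφ]
      simp only
      rw [← Complex.ofReal_sinh, hsu]
      have h3 : σ * δ * (|y| / δ) = y := by
        calc σ * δ * (|y| / δ) = σ * |y| := by field_simp
          _ = y := hσy
      have h4 : -d + y = -d + σ * δ * (|y| / δ) := by rw [h3]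
      rw [h4, Complex.ofReal_exp]
      push_cast
      rfl
    simpa [Function.comp, hφu] using key
  · intro v hv
    have hv0 : v.re = 0 := hv
    have hvI : v = v.im * Complex.I := by
      apply Complex.ext <;> simp [hv0]
    have h3 : φ v = polar (Real.exp (-d)) (σ * δ * Real.sin v.im) := by
      rw [hφ, polar]
      simp only
      rw [Complex.ofReal_exp, ← Complex.exp_add]
      congr 1
      conv_lhs => rw [hvI]
      rw [Complex.sinh_mul_I]
      push_cast
      ring
    rw [Function.comp, h3]
    refine hA _ ?_
    rw [abs_mul, abs_mul, hσ, one_mul, abs_of_pos hδ]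
    exact mul_le_of_le_one_right hδ.le (Real.abs_sin_le_one _)
  · intro v hv
    have hv1 : v.re = 1 := hv
    exact hbound v (by change 0 ≤ v.re ∧ v.re ≤ 1; rw [hv1]; norm_num)

/-- Comparison of `F(r)` and `F(r e^y)`, `r = e^(-d)`. If `F(r)` is not too small, `norm_le_of_arc`
is applied to `F / F(r) - 1`, and otherwise to `F` itself. -/
lemma norm_sub_le_of_arc {F : ℂ → ℂ} (hF : DifferentiableOn ℂ F (Metric.ball 0 1))
    {d δ ε X y : ℝ} (hδ : 0 < δ) (hδd : 4 * δ ≤ d) (hy : |y| / δ * X ≤ 1)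
    (hX : 4 ≤ X) (hε : 0 < ε) (hε1 : ε < 1)
    (hA : ∀ θ, |θ| ≤ δ →
      ‖F (polar (Real.exp (-d)) θ) / F (Real.exp (-d) : ℝ) - 1‖ ≤ ε)
    (hB : ∀ z : ℂ, Real.exp (-(2 * d)) ≤ ‖z‖ → ‖z‖ ≤ Real.exp (-(d / 2)) →
      ‖F z‖ ≤ Real.exp (X / 240)) :
    ‖F ((Real.exp (-d + y) : ℝ) : ℂ) - F (Real.exp (-d) : ℝ)‖
      ≤ 3 * √ε * ‖F (Real.exp (-d) : ℝ)‖ + 7 * Real.exp (-(X / 80)) := by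
  set r := Real.exp (-d) with hr
  have hF0 : F r ≠ 0 := fun h => by
    have := hA 0 (by simpa using hδ.le)
    rw [h] at this
    norm_num at this
    linarith
  have hFn : 0 < ‖F r‖ := norm_pos_iff.2 hF0
  have hyδ : 0 ≤ |y| / δ := by positivity
  have hyδ4 : |y| / δ ≤ 1 / 4 := by nlinarith
  have hyle : |y| ≤ δ := by rw [div_le_iff₀ hδ] at hyδ4; linarith
  have hE := Real.exp_pos (-(X / 80))
  have he1 : Real.exp 1 ≤ 3 := by linarith [Real.exp_one_lt_d9]
  rcases le_total (Real.exp (-(X / 80))) ‖F r‖ with h | h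
  · have hf : DifferentiableOn ℂ (fun z => F z / F r - 1) (Metric.ball 0 1) :=
      (hF.div_const _).sub_const _
    obtain ⟨u, hu0, hu, hle⟩ := norm_le_of_arc hf (B := Real.exp X) hδ hδd hyle hA
      fun z h1 h2 => by
        have h3 : ‖F z / F r‖ ≤ Real.exp (X / 60) := by
          rw [norm_div, div_le_iff₀ hFn]
          calc ‖F z‖ ≤ Real.exp (X / 240) := hB z h1 h2
            _ ≤ Real.exp (X / 60) * Real.exp (-(X / 80)) := by
              rw [← Real.exp_add]; exact Real.exp_le_exp.2 (by linarith)
            _ ≤ _ := by gcongr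
        have h4 : (1 : ℝ) ≤ Real.exp (X / 60) := Real.one_le_exp (by linarith)
        have h5 : 2 ≤ Real.exp 1 := by linarith [Real.exp_one_gt_d9]
        calc ‖F z / F r - 1‖ ≤ ‖F z / F r‖ + ‖(1 : ℂ)‖ := norm_sub_le _ _
          _ ≤ Real.exp 1 * Real.exp (X / 60) := by rw [norm_one]; nlinarith
          _ ≤ Real.exp X := by rw [← Real.exp_add]; exact Real.exp_le_exp.2 (by linarith)
    have h6 : ε ^ (1 - u) ≤ √ε := by
      rw [Real.sqrt_eq_rpow]
      exact Real.rpow_le_rpow_of_exponent_ge hε hε1.le (by linarith)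
    have h7 : Real.exp X ^ u ≤ 3 := by
      rw [← Real.exp_mul]
      refine (Real.exp_le_exp.2 (?_ : X * u ≤ 1)).trans he1
      nlinarith
    have h8 : ‖F ((Real.exp (-d + y) : ℝ) : ℂ) / F r - 1‖ ≤ √ε * 3 := hle.trans (by gcongr)
    rw [div_sub_one hF0, norm_div, div_le_iff₀ hFn] at h8
    linarith
  · obtain ⟨u, hu0, hu, hle⟩ := norm_le_of_arc hF (A := 2 * Real.exp (-(X / 80)))
      (B := Real.exp (X / 240)) hδ hδd hyle (fun θ hθ => by
        have h1 := hA θ hθ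
        rw [div_sub_one hF0, norm_div, div_le_iff₀ hFn] at h1
        have h2 := norm_le_norm_add_norm_sub' (F (polar r θ)) (F r)
        nlinarith) hB
    have h3 : u * X ≤ 1 := (mul_le_mul_of_nonneg_right hu (by linarith)).trans hy
    have h4 : (2 * Real.exp (-(X / 80))) ^ (1 - u) * Real.exp (X / 240) ^ u
        ≤ 6 * Real.exp (-(X / 80)) := by
      rw [Real.mul_rpow (by norm_num) hE.le, ← Real.exp_mul, ← Real.exp_mul, mul_assoc,
        ← Real.exp_add]
      have h5 : (2 : ℝ) ^ (1 - u) ≤ 2 := by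
        conv_rhs => rw [← Real.rpow_one 2]
        exact Real.rpow_le_rpow_of_exponent_le (by norm_num) (by linarith)
      calc (2 : ℝ) ^ (1 - u) * Real.exp (-(X / 80) * (1 - u) + X / 240 * u)
          ≤ 2 * (Real.exp 1 * Real.exp (-(X / 80))) := by
            rw [← Real.exp_add]
            exact mul_le_mul h5 (Real.exp_le_exp.2 (by nlinarith)) (Real.exp_pos _).le (by norm_num)
        _ ≤ 2 * (3 * Real.exp (-(X / 80))) := by gcongr
        _ = _ := by ring
    have h6 := norm_sub_le (F ((Real.exp (-d + y) : ℝ) : ℂ)) (F r)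
    have : 0 ≤ 3 * √ε * ‖F r‖ := by positivity
    linarith

/-! ### Location of the saddle point and the coefficient asymptotics -/

/-- The saddle point equation `a(r) = n` is solvable. -/
lemma exists_logSeriesReal_one_eq (n : ℕ) :
    ∃ r : ℝ, 0 ≤ r ∧ r < 1 ∧ logSeriesReal 1 r = n := by
  have h0 : logSeriesReal 1 0 = 0 := by
    rw [logSeriesReal]
    simp [(expo_pos _).ne']
  obtain ⟨R, hR, hR1, hR2⟩ := (((tendsto_logSeriesReal_nhdsLT_one 1).eventually_ge_atTop n).and
    eventually_half_le).exists
  have hc : ContinuousOn (logSeriesReal 1) (Set.Icc 0 R) := by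
    have h1 : logSeriesReal 1 = fun r : ℝ => (logSeries 1 r).re := by
      ext r; rw [logSeries_ofReal, Complex.ofReal_re]
    rw [h1]
    intro r hr
    have hn : ‖(r : ℂ)‖ < 1 := by
      rw [Complex.norm_real, Real.norm_of_nonneg hr.1]; exact hr.2.trans_lt hR2
    have h2 := (logSeries_differentiableAt_and_mul_deriv 1 hn).1.continuousAt
    have h3 : ContinuousAt (fun r : ℝ => logSeries 1 r) r :=
      ContinuousAt.comp (f := fun r : ℝ => (r : ℂ)) h2 Complex.continuous_ofReal.continuousAt
    exact (Complex.continuous_re.continuousAt.comp h3).continuousWithinAt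
  obtain ⟨r, hr, hrn⟩ := intermediate_value_Icc (by linarith) hc
    (show (n : ℝ) ∈ Set.Icc (logSeriesReal 1 0) (logSeriesReal 1 R) from
      ⟨by rw [h0]; positivity, hR⟩)
  exact ⟨r, hr.1, hr.2.trans_lt hR2, hrn⟩

/-- The saddle point `r = e^(-d)` with `a(r) = n` in terms of `n`: crude bounds for `d`, and its
distance from the first-order approximation `(2 ζ(3) / n) ^ (1/3)`. -/
lemma exists_saddle_bounds : ∃ C : ℝ, 0 < C ∧ ∀ n : ℕ, (128 : ℝ) ≤ n → ∀ d : ℝ, 0 < d →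
    logSeriesReal 1 (Real.exp (-d)) = n →
    d ≤ 1 / 2 ∧ d ^ 3 ≤ 16 / n ∧ 1 / (2 * n) ≤ d ^ 3 ∧
    |d - (2 * zetaThree / n) ^ (1 / 3 : ℝ)| ≤ C * (n : ℝ) ^ (-(5 / 6) : ℝ) := by
  obtain ⟨C, hC, hCd⟩ := exists_abs_logSeriesReal_one_sub_le
  refine ⟨2 * C, by positivity, fun n hn d hd hdn => ?_⟩
  have hn0 : (0 : ℝ) < n := by linarith
  have hz := zetaThree_pos
  have h1 : d ^ 3 ≤ 16 / n := by
    have := logSeriesReal_le 1 hd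
    rw [hdn] at this
    rw [le_div_iff₀ (by positivity)]
    calc d ^ 3 * n ≤ d ^ 3 * ((1).factorial * (2 / d) ^ 1 * (8 / d ^ 2)) := by gcongr
      _ = 16 := by simp; field_simp; norm_num
  have h2 : d ≤ 1 / 2 := by
    have : d ^ 3 ≤ (1 / 2) ^ 3 := by
      refine h1.trans ?_
      rw [div_le_iff₀ hn0]; linarith
    exact le_of_pow_le_pow_left₀ (by norm_num) (by norm_num) this
  have hr : Real.exp (-d) < 1 := Real.exp_lt_one_iff.2 (by linarith)
  have h3 : 1 / (2 * n) ≤ d ^ 3 := by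
    have h4 := le_logSeriesReal 1 (Real.exp_pos (-d)) hr
    rw [hdn, Real.log_exp, neg_neg, div_le_iff₀ (by positivity)] at h4
    have h5 := Real.add_one_le_exp (-d)
    rw [div_le_iff₀ (by positivity)]
    have : d ^ (1 + 2) = d ^ 3 := rfl
    rw [this] at h4
    linarith
  refine ⟨h2, h1, h3, ?_⟩
  set d₀ := (2 * zetaThree / n) ^ (1 / 3 : ℝ) with hd₀
  have hd₀0 : 0 < d₀ := by positivity
  have hd₀3 : d₀ ^ 3 = 2 * zetaThree / n := by
    rw [hd₀, ← Real.rpow_natCast, ← Real.rpow_mul (by positivity)]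
    norm_num
  have h4 := hCd d hd
  rw [hdn] at h4
  have h5 : |d - d₀| * d ^ 2 ≤ C * d ^ (-(3 / 2) : ℝ) * d ^ 3 / n := by
    have e1 : d ^ 3 - d₀ ^ 3 = (n - 2 * zetaThree / d ^ 3) * (d ^ 3 / n) := by
      rw [hd₀3]; field_simp
    have e2 : d ^ 3 - d₀ ^ 3 = (d - d₀) * (d ^ 2 + d * d₀ + d₀ ^ 2) := by ring
    calc |d - d₀| * d ^ 2 ≤ |d - d₀| * (d ^ 2 + d * d₀ + d₀ ^ 2) := by
          gcongr
          have : 0 < d * d₀ := by positivity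
          nlinarith [sq_nonneg d₀]
      _ = |d ^ 3 - d₀ ^ 3| := by
          rw [e2, abs_mul, abs_of_nonneg (a := d ^ 2 + d * d₀ + d₀ ^ 2) (by positivity)]
      _ = |n - 2 * zetaThree / d ^ 3| * (d ^ 3 / n) := by
          rw [e1, abs_mul, abs_of_nonneg (a := d ^ 3 / n) (by positivity)]
      _ ≤ C * d ^ (-(3 / 2) : ℝ) * (d ^ 3 / n) := by gcongr
      _ = _ := by ring
  have h6 : |d - d₀| ≤ C * d ^ (-(1 / 2) : ℝ) / n := by
    have e : C * d ^ (-(3 / 2) : ℝ) * d ^ 3 / n = C * d ^ (-(1 / 2) : ℝ) / n * d ^ 2 := by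
      have : d ^ (-(3 / 2) : ℝ) * d = d ^ (-(1 / 2) : ℝ) := by
        rw [← Real.rpow_add_one hd.ne']; norm_num
      rw [← this]; ring
    rw [e] at h5
    exact le_of_mul_le_mul_right h5 (by positivity)
  refine h6.trans ?_
  have h7 : d ^ (-(1 / 2) : ℝ) ≤ 2 * (n : ℝ) ^ (1 / 6 : ℝ) := by
    have h8 : (d ^ 3) ^ (-(1 / 6) : ℝ) ≤ (1 / (2 * (n : ℝ))) ^ (-(1 / 6) : ℝ) :=
      Real.rpow_le_rpow_of_nonpos (by positivity) h3 (by norm_num)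
    have h9 : (d ^ 3) ^ (-(1 / 6) : ℝ) = d ^ (-(1 / 2) : ℝ) := by
      rw [← Real.rpow_natCast, ← Real.rpow_mul hd.le]; norm_num
    have h10 : (1 / (2 * (n : ℝ))) ^ (-(1 / 6) : ℝ) = 2 ^ (1 / 6 : ℝ) * (n : ℝ) ^ (1 / 6 : ℝ) := by
      rw [one_div, Real.inv_rpow (by positivity), Real.rpow_neg (by positivity), inv_inv,
        Real.mul_rpow (by norm_num) hn0.le]
    rw [h9, h10] at h8
    refine h8.trans ?_
    gcongr
    conv_rhs => rw [← Real.rpow_one 2]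
    exact Real.rpow_le_rpow_of_exponent_le (by norm_num) (by norm_num)
  calc C * d ^ (-(1 / 2) : ℝ) / n ≤ C * (2 * (n : ℝ) ^ (1 / 6 : ℝ)) / n := by gcongr
    _ = 2 * C * ((n : ℝ) ^ (1 / 6 : ℝ) / n) := by ring
    _ = _ := by
      rw [← Real.rpow_sub_one hn0.ne']; norm_num

/-- The loss `|y| / δ = O(n^(-5/18) log n)` in the three lines theorem is `o(1 / rate n)`. -/
lemma eventually_mul_log_mul_rpow_mul_rate_le_one (K : ℝ) : ∀ᶠ x : ℝ in atTop,
    K * (2 * Real.log x * x ^ (-(5 / 18) : ℝ)) * rate x ≤ 1 := by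
  have h := (tendsto_rpow_neg_atTop (by norm_num : (0 : ℝ) < 1 / 18)).const_mul (2 * |K|)
  rw [mul_zero] at h
  filter_upwards [h.eventually (ge_mem_nhds one_pos), eventually_ge_atTop (Real.exp 1)] with x hx h1
  have h0 : 0 < x := (Real.exp_pos 1).trans_le h1
  have hl : 1 ≤ Real.log x := (Real.le_log_iff_exp_le h0).2 h1
  have e : (2 * Real.log x * x ^ (-(5 / 18) : ℝ)) * rate x
      = 2 * x ^ (-(1 / 18) : ℝ) / Real.log x := by
    have : x ^ (-(1 / 18) : ℝ) = x ^ (-(5 / 18) : ℝ) * x ^ (2 / 9 : ℝ) := by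
      rw [← Real.rpow_add h0]; norm_num
    rw [rate, this]
    field_simp
  rw [mul_assoc, e]
  calc K * (2 * x ^ (-(1 / 18) : ℝ) / Real.log x) ≤ |K| * (2 * x ^ (-(1 / 18) : ℝ) / 1) := by
        gcongr
        exact le_abs_self K
    _ = 2 * |K| * x ^ (-(1 / 18) : ℝ) := by ring
    _ ≤ 1 := hx

/-- Condition (B) on the annulus around the saddle point. There `1 - |z|` is at least of order
`d ≍ n^(-1/3)`, so `log |F|` is `O(n^(η/3))`, which is below the rate as `η / 3 < 2 / 9`. -/
lemma eventually_norm_le_of_conditionB {F : ℂ → ℂ} (hF : ConditionB F) :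
    ∀ᶠ n : ℕ in atTop, ∀ d : ℝ, 0 < d → d ≤ 1 / 2 → d ^ 3 ≤ 16 / n → 1 / (2 * (n : ℝ)) ≤ d ^ 3 →
      ∀ z : ℂ, Real.exp (-(2 * d)) ≤ ‖z‖ → ‖z‖ ≤ Real.exp (-(d / 2)) →
        ‖F z‖ ≤ Real.exp (rate n / 240) := by
  obtain ⟨C, η, hC, hη, hη2, hO⟩ := hF
  obtain ⟨K, hK, hO⟩ := hO.exists_pos
  obtain ⟨R, hR, hR2⟩ := (mem_nhdsLT_iff_exists_Ioo_subset' (zero_lt_one' ℝ)).1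
    (eventually_comap.1 hO.bound)
  rw [Set.mem_Iio] at hR
  have hlim : Tendsto (fun n : ℕ => (16 : ℝ) / n) atTop (𝓝 0) :=
    tendsto_natCast_atTop_atTop.const_div_atTop _
  filter_upwards [hlim.eventually (gt_mem_nhds (show 0 < ((1 - R) / 2) ^ 3 by
      have : 0 < 1 - R := by linarith
      positivity)),
    tendsto_natCast_atTop_atTop.eventually (eventually_mul_rpow_le_rate
      (show η / 3 < 2 / 9 by linarith) (240 * (K + C * 8))),
    eventually_ge_atTop 1] with n hn hrate hn1 d hd hd2 hd16 hdlo z hz1 hz2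
  have hn1' : (1 : ℝ) ≤ n := by exact_mod_cast hn1
  have hdR : d < (1 - R) / 2 := by
    refine lt_of_pow_lt_pow_left₀ 3 (by linarith) (hd16.trans_lt hn)
  have hzR : R < ‖z‖ := by
    have := Real.add_one_le_exp (-(2 * d))
    linarith
  have hgap : d / 4 ≤ 1 - ‖z‖ := by
    have h2 : Real.exp (-(d / 2)) * (1 + d / 2) ≤ 1 := by
      have h3 := Real.add_one_le_exp (d / 2)
      have h4 : Real.exp (-(d / 2)) * Real.exp (d / 2) = 1 := by rw [← Real.exp_add]; simp
      have h5 := Real.exp_pos (-(d / 2))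
      nlinarith
    have h6 := Real.exp_pos (-(d / 2))
    nlinarith
  have hz3 : ‖z‖ < 1 := by linarith
  have h1 : ‖F z‖ ≤ K * ‖Real.exp (C / (1 - ‖z‖) ^ η)‖ := hR2 ⟨hzR, hz3⟩ z rfl
  rw [Real.norm_of_nonneg (Real.exp_pos _).le] at h1
  have hexp : C / (1 - ‖z‖) ^ η ≤ C * 8 * (n : ℝ) ^ (η / 3) := by
    have h2 : C / (1 - ‖z‖) ^ η ≤ C / (d / 4) ^ η := by gcongr
    refine h2.trans ?_
    rw [mul_assoc, div_eq_mul_inv, ← Real.inv_rpow (by positivity)]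
    have h3 : (d / 4)⁻¹ ≤ 8 * (n : ℝ) ^ (1 / 3 : ℝ) := by
      refine le_of_pow_le_pow_left₀ (n := 3) (by norm_num) (by positivity) ?_
      have h4 : (8 * (n : ℝ) ^ (1 / 3 : ℝ)) ^ 3 = 512 * n := by
        rw [mul_pow, ← Real.rpow_natCast ((n : ℝ) ^ (1 / 3 : ℝ)), ← Real.rpow_mul (by positivity)]
        norm_num
      rw [h4, inv_pow, inv_le_comm₀ (by positivity) (by positivity)]
      calc (512 * (n : ℝ))⁻¹ ≤ 1 / (2 * (n : ℝ)) / 64 := by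
            rw [inv_eq_one_div, div_div]
            apply one_div_le_one_div_of_le <;> nlinarith
        _ ≤ d ^ 3 / 64 := by gcongr
        _ = (d / 4) ^ 3 := by ring
    have h5 : ((d / 4)⁻¹) ^ η ≤ (8 * (n : ℝ) ^ (1 / 3 : ℝ)) ^ η := by gcongr
    rw [Real.mul_rpow (by norm_num) (by positivity), ← Real.rpow_mul (by positivity)] at h5
    have h6 : (8 : ℝ) ^ η ≤ 8 := by
      conv_rhs => rw [← Real.rpow_one 8]
      exact Real.rpow_le_rpow_of_exponent_le (by norm_num) (by linarith)
    have h7 : (1 / 3 * η : ℝ) = η / 3 := by ring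
    rw [h7] at h5
    gcongr
    exact h5.trans (by gcongr)
  have hpow : 1 ≤ (n : ℝ) ^ (η / 3) := Real.one_le_rpow hn1' (by positivity)
  calc ‖F z‖ ≤ K * Real.exp (C / (1 - ‖z‖) ^ η) := h1
    _ ≤ Real.exp K * Real.exp (C * 8 * (n : ℝ) ^ (η / 3)) := by
        gcongr
        linarith [Real.add_one_le_exp K]
    _ ≤ Real.exp (rate n / 240) := by
        rw [← Real.exp_add, Real.exp_le_exp]
        nlinarith

/-- Absorbing the part of the error that is small relative to `G n` into a factor `1 + o(1)`. -/
lemma exists_tendsto_zero_isBigO {T G : ℕ → ℂ} {E : ℕ → ℝ} {K : ℝ} (hK : 0 < K)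
    (hE : ∀ n, 0 < E n) (h : ∀ κ : ℝ, 0 < κ → ∀ᶠ n in atTop, ‖T n - G n‖ ≤ κ * ‖G n‖ + K * E n) :
    ∃ e : ℕ → ℂ, Tendsto e atTop (𝓝 0) ∧ (fun n => T n - G n * (1 + e n)) =O[atTop] E := by
  classical
  refine ⟨fun n => if ‖T n - G n‖ ≤ 2 * K * E n then 0 else (T n - G n) / G n, ?_, ?_⟩
  · rw [Metric.tendsto_nhds]
    intro κ hκ
    filter_upwards [h (κ / 4) (by positivity)] with n hn
    rw [dist_zero_right]
    split_ifs with hif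
    · simpa using hκ
    · have hE' := mul_pos hK (hE n)
      have h1 : ‖T n - G n‖ ≤ κ / 2 * ‖G n‖ := by linarith
      rcases eq_or_ne (G n) 0 with h0 | h0
      · simpa [h0] using hκ
      · have hG := norm_pos_iff.2 h0
        rw [norm_div, div_lt_iff₀ hG]
        nlinarith
  · refine IsBigO.of_bound (2 * K) ?_
    filter_upwards [h 1 one_pos, h (1 / 4) (by norm_num)] with n hn hn4
    rw [Real.norm_of_nonneg (hE n).le]
    have hE' := mul_pos hK (hE n)
    split_ifs with hif
    · simpa using hif
    · rcases eq_or_ne (G n) 0 with h0 | h0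
      · rw [h0, norm_zero] at hn
        rw [h0] at hif
        linarith
      · have : T n - G n * (1 + (T n - G n) / G n) = 0 := by field_simp; ring
        rw [this, norm_zero]
        linarith

/-- A triangle inequality through `A` in which the relative errors are with respect to `A` in the
hypotheses and to `G` in the conclusion. -/
lemma norm_sub_le_of_intermediate {T A G : ℂ} {ρ κ E : ℝ} (hρ0 : 0 ≤ ρ) (hρ6 : ρ ≤ 1 / 6)
    (hρκ : 18 * ρ ≤ κ) (hE0 : 0 ≤ E) (hT : ‖T - A‖ ≤ 6 * ρ ^ 2 * ‖A‖ + E)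
    (hG : ‖G - A‖ ≤ 3 * ρ * ‖A‖ + 7 * E) : ‖T - G‖ ≤ κ * ‖G‖ + 29 * E := by
  have hAG : ‖A‖ ≤ ‖G‖ + ‖G - A‖ := by
    have := norm_sub_le G (G - A)
    rwa [sub_sub_cancel] at this
  have hTG : ‖T - G‖ ≤ ‖T - A‖ + ‖G - A‖ := by
    have := norm_sub_le (T - A) (G - A)
    rwa [sub_sub_sub_cancel_right] at this
  have hA0 := norm_nonneg A
  have hG0 := norm_nonneg G
  have h3 : ρ ^ 2 * ‖A‖ ≤ ρ * ‖A‖ := by gcongr; nlinarith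
  have h4 : ρ * ‖A‖ ≤ 1 / 6 * ‖A‖ := by gcongr
  have h5 : ‖A‖ ≤ 2 * ‖G‖ + 14 * E := by linarith
  have h6 : ρ * ‖A‖ ≤ ρ * (2 * ‖G‖ + 14 * E) := by gcongr
  have h7 : ρ * E ≤ 1 / 6 * E := by gcongr
  have h8 : 18 * ρ * ‖G‖ ≤ κ * ‖G‖ := by gcongr
  linarith

/-- The coefficient asymptotics with the two error terms side by side. -/
lemma eventually_norm_coeff_ratio_sub_le {β : ℝ} {d : ℕ → ℝ} {F : ℂ → ℂ} (hβ : 0 < β)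
    (hd : (fun n : ℕ => d n - ((2 * (riemannZeta 3).re / (n : ℝ)) ^ (1 / 3 : ℝ)
      - 1 / (36 * (n : ℝ)))) =O[atTop] fun n : ℕ => (n : ℝ) ^ (-1 - β))
    (hF : DifferentiableOn ℂ F (Metric.ball 0 1)) (hA : ConditionA F locδ) (hB : ConditionB F)
    {κ : ℝ} (hκ : 0 < κ) :
    ∀ᶠ n : ℕ in atTop, ‖taylorCoeff (fun x => Q x * F x) n / q n - F (Real.exp (-d n) : ℝ)‖
      ≤ κ * ‖F (Real.exp (-d n) : ℝ)‖ + 29 * Real.exp (-(rate n / 80)) := by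
  obtain ⟨C, hC, hsad⟩ := exists_saddle_bounds
  obtain ⟨K, hK, hdK⟩ := hd.exists_pos
  set ρ := min κ 3 / 18 with hρ
  have hρ0 : 0 < ρ := by
    have : 0 < min κ 3 := lt_min hκ (by norm_num)
    positivity
  have hρκ : 18 * ρ ≤ κ := by rw [hρ]; linarith [min_le_left κ 3]
  have hρ6 : ρ ≤ 1 / 6 := by rw [hρ]; linarith [min_le_right κ 3]
  have hcast := tendsto_natCast_atTop_atTop (R := ℝ)
  have hlog0 : Tendsto (fun x => 3072 / Real.log x ^ 3) atTop (𝓝 0) :=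
    ((tendsto_pow_atTop (by norm_num)).comp Real.tendsto_log_atTop).const_div_atTop _
  filter_upwards [hA (ρ ^ 2) (by positivity), eventually_norm_le_of_conditionB hB, hdK.bound,
    hcast.eventually (hlog0.eventually (ge_mem_nhds (by norm_num : (0 : ℝ) < 1 / 2))),
    hcast.eventually (eventually_mul_log_le_rate 360),
    hcast.eventually (tendsto_rate.eventually_ge_atTop 4),
    hcast.eventually (eventually_mul_log_mul_rpow_mul_rate_le_one (C + 1 + K)),
    hcast.eventually (eventually_ge_atTop 4000)] with n hAn hBn hdn hlog hrate hrate4 hy hn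
  have hn0 : (0 : ℝ) < n := by linarith
  obtain ⟨r, hr0, hr1, hrn⟩ := exists_logSeriesReal_one_eq n
  -- condition (A) asks for `0 < r`, which holds since `a(0) = 0 < n`
  have hr0' : 0 < r := by
    refine lt_of_le_of_ne hr0 fun h => ?_
    rw [← h] at hrn
    simp [logSeriesReal, (expo_pos _).ne'] at hrn
    rw [← hrn] at hn0
    simp at hn0
  set D := -Real.log r with hD
  have hD0 : 0 < D := by linarith [Real.log_neg hr0' hr1]
  have hrD : Real.exp (-D) = r := by rw [hD, neg_neg, Real.exp_log hr0']
  obtain ⟨hD2, hD16, hDlo, hDd⟩ := hsad n (by linarith) D hD0 (by rw [hrD, hrn])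
  have hr2 : 1 / 2 ≤ r := by
    rw [← hrD]; linarith [Real.add_one_le_exp (-D)]
  have ha : 3 ≤ logSeriesReal 1 r := by rw [hrn]; linarith
  obtain ⟨hδ0, -, -, -, -⟩ := locδ_bounds hr2 hr1 ha
  have hδeq : locδ r = D ^ (5 / 3 : ℝ) / Real.log n := by
    rw [locδ, haymanA_Q hr0 hr1, hrn]
  have hl4 : 4 ≤ Real.log n := by
    rw [Real.le_log_iff_exp_le hn0]
    have h3 : Real.exp 4 = Real.exp 1 ^ 4 := by rw [← Real.exp_nat_mul]; norm_num
    have h4 : Real.exp 1 ^ 4 ≤ 3 ^ 4 := by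
      gcongr; linarith [Real.exp_one_lt_d9]
    rw [h3]
    linarith
  have hδD : 4 * locδ r ≤ D := by
    have h3 := Real.rpow_le_rpow_of_exponent_ge hD0 (by linarith) (by norm_num : (1 : ℝ) ≤ 5 / 3)
    rw [Real.rpow_one] at h3
    rw [hδeq, mul_div_assoc', div_le_iff₀ (by linarith)]
    nlinarith
  have hδlo : (n : ℝ) ^ (-(5 / 9) : ℝ) / (2 * Real.log n) ≤ locδ r := by
    have h3 : (1 / (2 * (n : ℝ))) ^ (5 / 9 : ℝ) ≤ (D ^ 3) ^ (5 / 9 : ℝ) := by gcongr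
    have h4 : (D ^ 3) ^ (5 / 9 : ℝ) = D ^ (5 / 3 : ℝ) := by
      rw [← Real.rpow_natCast, ← Real.rpow_mul hD0.le]; norm_num
    have h5 : (n : ℝ) ^ (-(5 / 9) : ℝ) / 2 ≤ (1 / (2 * (n : ℝ))) ^ (5 / 9 : ℝ) := by
      have h6 : (2 : ℝ) ^ (5 / 9 : ℝ) ≤ 2 := by
        conv_rhs => rw [← Real.rpow_one 2]
        exact Real.rpow_le_rpow_of_exponent_le (by norm_num) (by norm_num)
      rw [one_div, Real.inv_rpow (by positivity), Real.mul_rpow (by norm_num) hn0.le, mul_inv,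
        Real.rpow_neg hn0.le, div_eq_inv_mul]
      gcongr
    rw [hδeq, ← div_div]
    rw [h4] at h3
    gcongr
    exact h5.trans h3
  set y := D - d n with hydef
  have hyn : |y| ≤ (C + 1 + K) * (n : ℝ) ^ (-(5 / 6) : ℝ) := by
    rw [riemannZeta_three_re, Real.norm_eq_abs, Real.norm_of_nonneg (by positivity)] at hdn
    set d₀ := (2 * zetaThree / n) ^ (1 / 3 : ℝ)
    have hn1 : (1 : ℝ) ≤ n := by linarith
    have h3 : (n : ℝ) ^ (-1 - β) ≤ (n : ℝ) ^ (-(5 / 6) : ℝ) :=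
      Real.rpow_le_rpow_of_exponent_le hn1 (by linarith)
    have h4 : 1 / (36 * (n : ℝ)) ≤ (n : ℝ) ^ (-(5 / 6) : ℝ) := by
      have h5 : (n : ℝ) ^ (-1 : ℝ) ≤ (n : ℝ) ^ (-(5 / 6) : ℝ) :=
        Real.rpow_le_rpow_of_exponent_le hn1 (by norm_num)
      rw [Real.rpow_neg_one] at h5
      refine le_trans ?_ h5
      rw [← one_div]
      apply one_div_le_one_div_of_le hn0
      linarith
    have h6 : 0 ≤ 1 / (36 * (n : ℝ)) := by positivity
    have h7 : K * (n : ℝ) ^ (-1 - β) ≤ K * (n : ℝ) ^ (-(5 / 6) : ℝ) := by gcongr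
    rw [abs_le] at hdn hDd ⊢
    constructor <;> linarith
  have hyX : |y| / locδ r * rate n ≤ 1 := by
    refine le_trans ?_ hy
    have hl0 : 0 < Real.log n := by linarith
    gcongr
    calc |y| / locδ r ≤ ((C + 1 + K) * (n : ℝ) ^ (-(5 / 6) : ℝ))
          / ((n : ℝ) ^ (-(5 / 9) : ℝ) / (2 * Real.log n)) := by gcongr
      _ = (C + 1 + K) *
          (2 * Real.log n * ((n : ℝ) ^ (-(5 / 6) : ℝ) / (n : ℝ) ^ (-(5 / 9) : ℝ))) := by field_simp
      _ = _ := by rw [← Real.rpow_sub hn0]; norm_num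
  have hArc : ∀ θ, |θ| ≤ locδ r → ‖F (polar r θ) / F r - 1‖ ≤ ρ ^ 2 :=
    hAn r hr0' hr1 (by rw [haymanA_Q hr0 hr1, hrn])
  have hAnn := hBn D hD0 hD2 hD16 hDlo
  have hρ1 : ρ ^ 2 < 1 := by nlinarith
  have hcoeff := norm_coeff_ratio_sub_le hF hr2 hr1 hrn hn hlog hrate hrate4 (sq_nonneg ρ) hρ1
    hArc (fun θ => hAnn _ (by rw [norm_polar hr0, ← hrD, Real.exp_le_exp]; linarith)
      (by rw [norm_polar hr0, ← hrD, Real.exp_le_exp]; linarith)) le_rfl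
  have htrans := norm_sub_le_of_arc hF (y := y) hδ0 hδD hyX hrate4
    (by positivity : 0 < ρ ^ 2) hρ1 (by rwa [hrD]) hAnn
  rw [Real.sqrt_sq hρ0.le, hrD, show -D + y = -d n by rw [hydef]; ring] at htrans
  exact norm_sub_le_of_intermediate hρ0.le hρ6 hρκ (Real.exp_pos _).le hcoeff htrans

end PlanePartition

theorem theorem1 :
    PlanePartition.HaymanAdmissible PlanePartition.Q PlanePartition.locδ ∧
    ∀ (β : ℝ) (d : ℕ → ℝ) (F : ℂ → ℂ), 0 < β →
      ((fun n : ℕ => d n - ((2 * (riemannZeta 3).re / (n : ℝ)) ^ (1 / 3 : ℝ)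
          - 1 / (36 * (n : ℝ)))) =O[atTop] fun n : ℕ => (n : ℝ) ^ (-1 - β)) →
      DifferentiableOn ℂ F (Metric.ball 0 1) →
      PlanePartition.ConditionA F PlanePartition.locδ →
      PlanePartition.ConditionB F →
      ∃ c : ℝ, 0 < c ∧ ∃ ε : ℕ → ℂ, Tendsto ε atTop (𝓝 0) ∧
        (fun n : ℕ =>
            PlanePartition.taylorCoeff (fun x => PlanePartition.Q x * F x) n / PlanePartition.q n
              - F (Real.exp (-d n) : ℝ) * (1 + ε n))
          =O[atTop] fun n : ℕ =>
            Real.exp (-c * (n : ℝ) ^ (2 / 9 : ℝ) / Real.log (n : ℝ) ^ 2) := by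
  refine ⟨PlanePartition.haymanAdmissible_Q, fun β d F hβ hd hF hA hB => ⟨1 / 80, by norm_num, ?_⟩⟩
  obtain ⟨e, he, hO⟩ := PlanePartition.exists_tendsto_zero_isBigO (K := 29) (by norm_num)
    (fun n : ℕ => Real.exp_pos (-(PlanePartition.rate n / 80))) fun κ hκ =>
      PlanePartition.eventually_norm_coeff_ratio_sub_le hβ hd hF hA hB hκ
  refine ⟨e, he, hO.congr_right fun n => ?_⟩
  rw [PlanePartition.rate]
  ring_nf
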